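/- Let $\mathbb{K}$ be an algebraically closed field of arbitrary characteristic. For integers $m,n\ge 1$ let $\mathcal{C}_{m,n}$ be the affine variety of $m\times n$ matrices over $\mathbb{K}$ of rank at most $1$. For integers $i,k\ge 1$ and $j\ge 2$ let $$\mathcal{N}_{i,j,k}=\{(M,N)\in\mathcal{C}_{j,k}\times\mathcal{C}_{i,j}\ :\ NM=0\},$$ a Zariski closed subset of the affine space of pairs of matrices of sizes $j\times k$ and $i\times j$, considered as a (reduced) affine variety. For a variety $X$, let $\operatorname{Sing}X$ be the set of points of $X$ at which the local ring of $X$ is not regular. Then $\mathcal{N}_{i,j,k}$ is irreducible of dimension $2j+i+k-3$, and it is singular at the point $(0,0)$. Moreover: (a) The singularity $(0,0)$ is isolated (that is, $(0,0)$ is an isolated point of $\operatorname{Sing}\mathcal{N}_{i,j,k}$) if and only if $j=2$ or $i=k=1$. (b) If $i>1$, $j>2$ and $k=1$, then $\operatorname{Sing}\mathcal{N}_{i,j,1}=\mathcal{C}_{j,1}\times\{0\}$. If $i=1$, $j>2$ and $k>1$, then $\operatorname{Sing}\mathcal{N}_{1,j,k}=\{0\}\times\mathcal{C}_{1,j}$.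 (c) If $i,k>1$ and $j>2$, then $\operatorname{Sing}\mathcal{N}_{i,j,k}$ has exactly two irreducible components, $\mathcal{C}_{j,k}\times\{0\}$ and $\{0\}\times\mathcal{C}_{i,j}$. (d) The variety $\mathcal{N}_{i,2,k}$ is isomorphic to $\mathcal{C}_{i+k,2}$. The variety $\mathcal{N}_{1,j,1}$ is a nondegenerate quadratic cone of dimension $2j-1$, that is, the set of zeros of a nondegenerate quadratic form on the $2j$-dimensional ambient vector space. -/

import Mathlib

/-! Classical affine algebraic geometry over a field `K`: algebraic subsets of the affine space
`K^σ` with the Zariski topology, their coordinate rings, local rings and singular points,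
followed by the varieties of matrices of rank at most one and of pairs of such matrices. -/

namespace RankOnePairs

open MvPolynomial

noncomputable section

/-- The affine space `K^σ`, to be equipped with the Zariski topology. -/
def AffSpace (K : Type*) (σ : Type*) : Type _ := σ → K

instance (K : Type*) [Field K] (σ : Type*) : AddCommGroup (AffSpace K σ) :=
  inferInstanceAs (AddCommGroup (σ → K))

instance (K : Type*) [Field K] (σ : Type*) : Module K (AffSpace K σ) :=
  inferInstanceAs (Module K (σ → K))

theorem zeroLocus_mul {K : Type*} [Field K] {σ : Type*} (I J : Ideal (MvPolynomial σ K)) :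
    zeroLocus K I ∪ zeroLocus K J = zeroLocus K (I * J) := by
  refine Set.Subset.antisymm ?_ ?_
  · exact Set.union_subset (zeroLocus_anti_mono (K := K) Ideal.mul_le_left)
      (zeroLocus_anti_mono (K := K) Ideal.mul_le_right)
  · intro x hx
    by_contra h
    obtain ⟨h1, h2⟩ := not_or.1 h
    simp only [mem_zeroLocus_iff, not_forall] at h1 h2
    obtain ⟨p, hp, hpx⟩ := h1
    obtain ⟨q, hq, hqx⟩ := h2
    have h3 := hx (p * q) (Ideal.mul_mem_mul hp hq)
    rw [map_mul] at h3
    exact (mul_ne_zero hpx hqx) h3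

/-- The Zariski topology: the closed sets are the zero loci of ideals of polynomials. -/
instance zariski (K : Type*) [Field K] (σ : Type*) : TopologicalSpace (AffSpace K σ) :=
  TopologicalSpace.ofClosed (X := σ → K)
    {Z : Set (σ → K) | ∃ I : Ideal (MvPolynomial σ K), Z = zeroLocus K I}
    ⟨⊤, zeroLocus_top.symm⟩
    (by
      intro A hA
      refine ⟨vanishingIdeal K (⋂₀ A), Set.Subset.antisymm
        (fun x hx p hp => hp x hx) (fun x hx Z hZ => ?_)⟩
      obtain ⟨I, rfl⟩ := hA hZ
      exact fun p hp => hx p (fun y hy => hy _ hZ p hp))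
    (by
      rintro _ ⟨I, rfl⟩ _ ⟨J, rfl⟩
      exact ⟨I * J, zeroLocus_mul I J⟩)

theorem isClosed_iff {K : Type*} [Field K] {σ : Type*} (Z : Set (AffSpace K σ)) :
    IsClosed Z ↔ ∃ I : Ideal (MvPolynomial σ K), Z = zeroLocus K I := by
  rw [← isOpen_compl_iff]
  change Zᶜᶜ ∈ {Z : Set (σ → K) | ∃ I : Ideal (MvPolynomial σ K), Z = zeroLocus K I} ↔ _
  rw [compl_compl]
  rfl

/-- The coordinate ring `K[X] = K[T_σ] / I(X)` of an algebraic set `X` in `K^σ`. -/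
abbrev CoordRing {K : Type*} [Field K] {σ : Type*} (X : Set (AffSpace K σ)) : Type _ :=
  MvPolynomial σ K ⧸ (vanishingIdeal K (X : Set (σ → K)))

/-- Evaluation of regular functions at a point of `X`. -/
def evalAt {K : Type*} [Field K] {σ : Type*} (X : Set (AffSpace K σ)) (x : X) :
    CoordRing X →ₐ[K] K :=
  Ideal.Quotient.liftₐ (vanishingIdeal K (X : Set (σ → K)))
    (aeval (R := K) (x.1 : σ → K)) (fun _ hp => hp x.1 x.2)

/-- The maximal ideal of the regular functions on `X` that vanish at `x`. -/
def pointIdeal {K : Type*} [Field K] {σ : Type*} (X : Set (AffSpace K σ)) (x : X) :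
    Ideal (CoordRing X) :=
  RingHom.ker (evalAt X x)

instance {K : Type*} [Field K] {σ : Type*} (X : Set (AffSpace K σ)) (x : X) :
    (pointIdeal X x).IsPrime :=
  RingHom.ker_isPrime (evalAt X x)

/-- The local ring of the algebraic set `X` at `x`. -/
abbrev LocalRingAt {K : Type*} [Field K] {σ : Type*} (X : Set (AffSpace K σ)) (x : X) : Type _ :=
  Localization.AtPrime (pointIdeal X x)

/-- The singular locus of the algebraic set `X`: the points of `X` whose local ring is not a
regular local ring. -/
def singularLocus {K : Type*} [Field K] {σ : Type*} (X : Set (AffSpace K σ)) :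
    Set (AffSpace K σ) :=
  {x | ∃ hx : x ∈ X, ¬ IsRegularLocalRing (LocalRingAt X ⟨x, hx⟩)}

/-- `x` is an isolated singularity of `X`: it is the only singular point of `X` in some Zariski
neighbourhood of `x`. -/
def IsIsolatedSingularity {K : Type*} [Field K] {σ : Type*} (X : Set (AffSpace K σ))
    (x : AffSpace K σ) : Prop :=
  ∃ U : Set (AffSpace K σ), IsOpen U ∧ U ∩ singularLocus X = {x}

/-- The irreducible components of a subset `Z` of `K^σ` with the induced Zariski topology, as
subsets of `K^σ`. -/
def componentsOf {K : Type*} [Field K] {σ : Type*} (Z : Set (AffSpace K σ)) :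
    Set (Set (AffSpace K σ)) :=
  (fun S : Set Z => Subtype.val '' S) '' irreducibleComponents Z

/-- A morphism between algebraic sets of affine spaces: a map given by polynomials. -/
def IsPolynomialMap {K : Type*} [Field K] {σ τ : Type*} {X : Set (AffSpace K σ)}
    {Y : Set (AffSpace K τ)} (f : X → Y) : Prop :=
  ∃ p : τ → MvPolynomial σ K, ∀ (x : X) (t : τ),
    (f x).1 t = aeval (R := K) (x.1 : σ → K) (p t)

/-- Isomorphism of algebraic sets. -/
def AlgIsomorphic {K : Type*} [Field K] {σ τ : Type*} (X : Set (AffSpace K σ))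
    (Y : Set (AffSpace K τ)) : Prop :=
  ∃ e : X ≃ Y, IsPolynomialMap e ∧ IsPolynomialMap e.symm

/-- `X` is a nondegenerate quadratic cone in its ambient affine space: the set of zeros of a
nondegenerate quadratic form (nondegenerate in the sense valid in every characteristic). -/
def IsNondegenerateQuadraticCone {K : Type*} [Field K] {σ : Type*}
    (X : Set (AffSpace K σ)) : Prop :=
  ∃ Q : QuadraticForm K (AffSpace K σ), Q.Nondegenerate ∧ X = {x | Q x = 0}

/-- The matrix with entries the coordinates of a point of `K^(m × n)`. -/
def toMat {K : Type*} {m n : ℕ} (x : AffSpace K (Fin m × Fin n)) : Matrix (Fin m) (Fin n) K :=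
  Matrix.of fun a b => x (a, b)

/-- `C_{m,n}`: the matrices of size `m × n` and rank at most one. -/
def rankLeOne (K : Type*) [Field K] (m n : ℕ) : Set (AffSpace K (Fin m × Fin n)) :=
  {x | (toMat x).rank ≤ 1}

/-- First component of a point of `K^(σ ⊕ τ) = K^σ × K^τ`. -/
def fstPart {K : Type*} {σ τ : Type*} (x : AffSpace K (σ ⊕ τ)) : AffSpace K σ :=
  fun s => x (Sum.inl s)

/-- Second component of a point of `K^(σ ⊕ τ) = K^σ × K^τ`. -/
def sndPart {K : Type*} {σ τ : Type*} (x : AffSpace K (σ ⊕ τ)) : AffSpace K τ :=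
  fun t => x (Sum.inr t)

/-- The product `A × B` inside `K^(σ ⊕ τ) = K^σ × K^τ`. -/
def prodSet {K : Type*} {σ τ : Type*} (A : Set (AffSpace K σ)) (B : Set (AffSpace K τ)) :
    Set (AffSpace K (σ ⊕ τ)) :=
  {x | fstPart x ∈ A ∧ sndPart x ∈ B}

/-- `N_{i,j,k} = {(M, N) ∈ C_{j,k} × C_{i,j} : N M = 0}`. -/
def pairVariety (K : Type*) [Field K] (i j k : ℕ) :
    Set (AffSpace K ((Fin j × Fin k) ⊕ (Fin i × Fin j))) :=
  {x | x ∈ prodSet (rankLeOne K j k) (rankLeOne K i j) ∧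
    toMat (sndPart x) * toMat (fstPart x) = 0}

end

end RankOnePairs

/-!
The variety of pairs is the image of an affine space under the polynomial map
`(B, u, v, w) ↦ (u vᵀ, w ((B - Bᵀ) u)ᵀ)`, because a vector `z` orthogonal to `u ≠ 0` has the form
`(B - Bᵀ) u`; so it is irreducible (`isIrreducible_pairVariety`).

Everything local is read off from one kind of chart. Where `M a b ≠ 0`, the matrix `M` is determined
by its row `a` and its column `b`, and `N M = 0` expresses column `a` of `N` through the other ones.
What remains of `N` is a matrix of rank at most one with `j - 1` columns. If it has an entry
`N e c ≠ 0`, it is determined by row `e` and column `c`; if it has a single row or a single column,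
there is nothing to determine. This singles out `2j + i + k - 3` coordinates which are algebraically
independent on the variety (`chartHom_chartCoord_injective`), while every regular function is, near
the point, a fraction in these coordinates (`fractionSubalgebra_chartCoord_eq_top`). Hence the
local ring is a localization of a polynomial ring, so it is regular
(`isRegularLocalRing_of_fractionSubalgebra_eq_top`). The same coordinates form a transcendence
basis, and Noether normalization together with going up turns their number into the dimension of the
coordinate ring (`ringKrullDim_eq_card_of_isTranscendenceBasis`), which by the Nullstellensatz is
the dimension of the variety (`topologicalKrullDim_eq_ringKrullDim_coordRing`). The case `M = 0`,
`N ≠ 0` is reduced to this one by `(M, N) ↦ (Nᵀ, Mᵀ)`.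

At the remaining points the variety contains more than `2j + i + k - 3` lines with independent
directions. Directions of lines are point derivations of the local ring, and a regular local ring
has no more independent ones than its dimension, so these points are singular
(`mem_singularLocus_of_lines`). Together this determines the singular locus
(`mem_singularLocus_pairVariety_iff`): besides the origin it consists of the points with `N = 0` if
`i > 1` and `j > 2`, and of those with `M = 0` if `k > 1` and `j > 2`.

For `j = 2` the orthogonality of a row of `N` and a column `(M 0 d, M 1 d)` of `M` is the vanishing
of the minor of that row and `(M 1 d, - M 0 d)`, so stacking these rows below `N` gives the
isomorphism with matrices of rank at most one (`algIsomorphic_pairVariety_two`). For `i = k = 1` the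
only equation is the hyperbolic form `N M`.
-/

namespace RankOnePairs

open MvPolynomial

/-! ### Dimension and regularity of finitely generated algebras -/

/-- An integral extension does not change the Krull dimension: incomparability bounds the dimension
of the larger ring, and going up bounds that of the smaller one. -/
theorem ringKrullDim_eq_of_isIntegral {R S : Type*} [CommRing R] [CommRing S] [IsDomain S]
    [Algebra R S] [Algebra.IsIntegral R S] (hinj : Function.Injective (algebraMap R S)) :
    ringKrullDim R = ringKrullDim S := by
  refine le_antisymm (iSup_le fun l => ?_)
    (Order.krullDim_le_of_strictMono (PrimeSpectrum.comap (algebraMap R S))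
      fun I J h => Ideal.IsIntegral.comap_lt_comap (R := R) h)
  have : FaithfulSMul R S := (faithfulSMul_iff_algebraMap_injective R S).2 hinj
  obtain ⟨P, hP, hPl⟩ := Ideal.exists_ideal_over_prime_of_isIntegral_of_isDomain
    (S := S) l.head.asIdeal (by
      rw [(RingHom.injective_iff_ker_eq_bot _).1 hinj]; exact bot_le)
  have : P.LiesOver l.head.asIdeal := ⟨hPl.symm⟩
  obtain ⟨L, hL, -, -⟩ := Ideal.exists_ltSeries_of_hasGoingUp l P
  rw [← hL]
  exact Order.LTSeries.length_le_krullDim L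

/-- The Krull dimension of a finitely generated domain over a field is its transcendence degree,
by Noether normalization. -/
theorem ringKrullDim_eq_card_of_isTranscendenceBasis {K A ι : Type*} [Field K] [CommRing A]
    [IsDomain A] [Algebra K A] [Algebra.FiniteType K A] [Fintype ι] {y : ι → A}
    (hy : IsTranscendenceBasis K y) : ringKrullDim A = Fintype.card ι := by
  obtain ⟨s, g, hg, hint⟩ := exists_integral_inj_algHom_of_fg K A
  algebraize [g.toRingHom]
  have halg : Algebra.IsIntegral (MvPolynomial (Fin s) K) A := ⟨hint⟩
  have h1 : ringKrullDim A = s := by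
    rw [← ringKrullDim_eq_of_isIntegral (R := MvPolynomial (Fin s) K) (S := A) hg,
      MvPolynomial.ringKrullDim_of_isNoetherianRing]
    simp
  have hbasis : IsTranscendenceBasis K (fun l => g (X l)) := by
    have hind : AlgebraicIndependent K (fun l => g (X l)) := by
      have := (MvPolynomial.algebraicIndependent_X (Fin s) K).map' hg
      exact this
    rw [hind.isTranscendenceBasis_iff_isAlgebraic]
    refine ⟨fun a => ?_⟩
    obtain ⟨p, hp, hpa⟩ := halg.isIntegral a
    have hmem : ∀ q, g q ∈ Algebra.adjoin K (Set.range fun l => g (X l)) := by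
      intro q
      rw [Algebra.adjoin_range_eq_range_aeval]
      refine ⟨q, ?_⟩
      have : (aeval fun l => g (X l)) = g := by ext; simp
      exact congrArg (fun φ => φ q) this
    let g' : MvPolynomial (Fin s) K →+* Algebra.adjoin K (Set.range fun l => g (X l)) :=
      g.toRingHom.codRestrict _ hmem
    refine IsIntegral.isAlgebraic ⟨p.map g', hp.map g', ?_⟩
    rw [Polynomial.eval₂_map]
    exact hpa
  have h2 := hy.lift_cardinalMk_eq hbasis
  simp only [Cardinal.mk_fintype, Cardinal.lift_natCast, Fintype.card_fin, Nat.cast_inj] at h2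
  rw [h1, h2]

section Fractions

variable {K A ι : Type*} [Field K] [CommRing A] [Algebra K A]

/-- The elements of `A` that become, after localization at the prime `P`, fractions with numerator
and denominator in the image of `φ`. -/
def fractionSubalgebra (φ : MvPolynomial ι K →ₐ[K] A) (P : Ideal A) [hP : P.IsPrime] :
    Subalgebra K A where
  carrier := {a | ∃ f g, φ f ∉ P ∧ a * φ f = φ g}
  mul_mem' := by
    rintro a b ⟨f, g, hf, h⟩ ⟨f', g', hf', h'⟩
    refine ⟨f * f', g * g', ?_, by rw [map_mul, map_mul, ← h, ← h']; ring⟩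
    rw [map_mul]
    exact fun h => (hP.mem_or_mem h).elim hf hf'
  add_mem' := by
    rintro a b ⟨f, g, hf, h⟩ ⟨f', g', hf', h'⟩
    refine ⟨f * f', g * f' + g' * f, ?_, by
      rw [map_mul, map_add, map_mul, map_mul, ← h, ← h']; ring⟩
    rw [map_mul]
    exact fun h => (hP.mem_or_mem h).elim hf hf'
  algebraMap_mem' := fun r => ⟨1, algebraMap _ _ r, by
    rw [map_one]; exact fun h => hP.ne_top ((Ideal.eq_top_iff_one _).2 h), by
    rw [map_one, mul_one, AlgHom.commutes]⟩

theorem apply_mem_fractionSubalgebra (φ : MvPolynomial ι K →ₐ[K] A) (P : Ideal A)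
    [hP : P.IsPrime] (q : MvPolynomial ι K) : φ q ∈ fractionSubalgebra φ P :=
  ⟨1, q, by rw [map_one]; exact fun h => hP.ne_top ((Ideal.eq_top_iff_one _).2 h), by simp⟩

theorem mem_fractionSubalgebra_of_mul_mem {φ : MvPolynomial ι K →ₐ[K] A} {P : Ideal A}
    [hP : P.IsPrime] {a b : A} (hb : b ∈ fractionSubalgebra φ P) (hbP : b ∉ P)
    (hab : a * b ∈ fractionSubalgebra φ P) : a ∈ fractionSubalgebra φ P := by
  obtain ⟨f, g, hf, h⟩ := hb
  obtain ⟨f', g', hf', h'⟩ := hab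
  have hg : φ g ∉ P := by
    rw [← h]
    exact fun h => (hP.mem_or_mem h).elim hbP hf
  refine ⟨g * f', g' * f, ?_, ?_⟩
  · rw [map_mul]
    exact fun h => (hP.mem_or_mem h).elim hg hf'
  · rw [map_mul, map_mul, ← h, ← h']
    ring

/-- If `A` is birational to affine space via `φ`, then the coordinates form a transcendence
basis. -/
theorem isTranscendenceBasis_of_fractionSubalgebra_eq_top [IsDomain A]
    (φ : MvPolynomial ι K →ₐ[K] A) (hφ : Function.Injective φ) (P : Ideal A) [P.IsPrime]
    (htop : fractionSubalgebra φ P = ⊤) : IsTranscendenceBasis K (fun l => φ (X l)) := by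
  have hind : AlgebraicIndependent K (fun l => φ (X l)) :=
    (MvPolynomial.algebraicIndependent_X ι K).map' hφ
  rw [hind.isTranscendenceBasis_iff_isAlgebraic]
  have hmem : ∀ q, φ q ∈ Algebra.adjoin K (Set.range fun l => φ (X l)) := by
    intro q
    rw [Algebra.adjoin_range_eq_range_aeval]
    refine ⟨q, ?_⟩
    have : (aeval fun l => φ (X l)) = φ := by ext; simp
    exact congrArg (fun ψ => ψ q) this
  refine ⟨fun a => ?_⟩
  obtain ⟨f, g, hf, h⟩ : a ∈ fractionSubalgebra φ P := htop ▸ Algebra.mem_top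
  have hf0 : φ f ≠ 0 := fun h => hf (h ▸ P.zero_mem)
  refine ⟨Polynomial.C ⟨φ f, hmem f⟩ * Polynomial.X - Polynomial.C ⟨φ g, hmem g⟩, ?_, ?_⟩
  · intro h0
    have := congrArg (fun p => Polynomial.coeff p 1) h0
    simp only [Polynomial.coeff_sub, Polynomial.coeff_C_mul, Polynomial.coeff_X_one, mul_one,
      Polynomial.coeff_C_succ, sub_zero, Polynomial.coeff_zero] at this
    exact hf0 (congrArg Subtype.val this)
  · simp only [map_sub, map_mul, Polynomial.aeval_C, Polynomial.aeval_X]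
    change φ f * a - φ g = 0
    rw [← h, mul_comm, sub_self]

/-- If `A` is birational to affine space via `φ` and every element of `A` is a fraction in the
coordinates with denominator outside `P`, then `A_P` is a localization of a polynomial ring, hence
regular. -/
theorem isRegularLocalRing_of_fractionSubalgebra_eq_top [IsDomain A] [Finite ι]
    (φ : MvPolynomial ι K →ₐ[K] A) (hφ : Function.Injective φ) (P : Ideal A) [P.IsPrime]
    (htop : fractionSubalgebra φ P = ⊤) : IsRegularLocalRing (Localization.AtPrime P) := by
  have key : ∀ a : A, ∃ f g, φ f ∉ P ∧ a * φ f = φ g := fun a =>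
    show a ∈ fractionSubalgebra φ P from htop ▸ Algebra.mem_top
  let Q : Ideal (MvPolynomial ι K) := P.comap φ
  have hinjA : Function.Injective (algebraMap A (Localization.AtPrime P)) :=
    IsLocalization.injective _ P.primeCompl_le_nonZeroDivisors
  let ψ : MvPolynomial ι K →+* Localization.AtPrime P :=
    (algebraMap A (Localization.AtPrime P)).comp φ.toRingHom
  let : Algebra (MvPolynomial ι K) (Localization.AtPrime P) := ψ.toAlgebra
  have hψ : ∀ q, algebraMap (MvPolynomial ι K) (Localization.AtPrime P) q =
    algebraMap A (Localization.AtPrime P) (φ q) := fun q => rfl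
  have hloc : IsLocalization.AtPrime (Localization.AtPrime P) Q := by
    refine ⟨fun q => ?_, fun z => ?_, fun {q r} h => ⟨1, ?_⟩⟩
    · rw [hψ]
      exact IsLocalization.map_units _ (⟨φ q, q.2⟩ : P.primeCompl)
    · obtain ⟨⟨a, s⟩, hz⟩ := IsLocalization.surj P.primeCompl z
      obtain ⟨f, g, hf, h⟩ := key a
      obtain ⟨f', g', hf', h'⟩ := key s
      have hg' : φ g' ∉ P := by
        rw [← h']
        exact fun h => ((inferInstance : P.IsPrime).mem_or_mem h).elim s.2 hf'
      refine ⟨(g * f', ⟨g' * f, ?_⟩), ?_⟩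
      · change φ (g' * f) ∉ P
        rw [map_mul]
        exact fun h => ((inferInstance : P.IsPrime).mem_or_mem h).elim hg' hf
      · change z * algebraMap A _ (φ (g' * f)) = algebraMap A _ (φ (g * f'))
        have hz' : z * algebraMap A _ s.1 = algebraMap A _ a := hz
        simp only [map_mul, ← h, ← h', ← hz']
        ring
    · rw [hψ, hψ] at h
      rw [hφ (hinjA h)]
  exact IsRegularLocalRing.of_ringEquiv
    (IsLocalization.algEquiv Q.primeCompl (Localization.AtPrime Q)
      (Localization.AtPrime P)).toRingEquiv

end Fractions

/-- A regular local ring `A_P` of a ring of dimension at most `d` has at most `d` independent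
point derivations at `P`: here `ev` is evaluation at the point, and the entries of `L` are the
derivations. -/
theorem finrank_le_of_isRegularLocalRing {K A V : Type*} [Field K] [CommRing A] [Algebra K A]
    [AddCommGroup V] [Module K V] [FiniteDimensional K V] (ev : A →ₐ[K] K) (P : Ideal A)
    [P.IsPrime] (hP : P = RingHom.ker ev) (L : A →ₗ[K] V)
    (hL : ∀ a b, L (a * b) = ev a • L b + ev b • L a)
    (hspan : ⊤ ≤ Submodule.span K (L '' (P : Set A))) {d : ℕ} (hd : ringKrullDim A = d)
    [hreg : IsRegularLocalRing (Localization.AtPrime P)] :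
    Module.finrank K V ≤ d := by
  subst hP
  set P : Ideal A := RingHom.ker ev with hP
  have hdim : (IsLocalRing.maximalIdeal (Localization.AtPrime P)).spanFinrank ≤ d := by
    have h1 : ringKrullDim (Localization.AtPrime P) ≤ d := by
      rw [IsLocalization.AtPrime.ringKrullDim_eq_height P, ← hd]
      exact Ideal.height_le_ringKrullDim_of_isPrime
    rw [← IsRegularLocalRing.spanFinrank_maximalIdeal] at h1
    exact_mod_cast h1
  obtain ⟨s, hs, hsm⟩ := Submodule.FG.exists_span_finset_card_eq_spanFinrank
    (IsNoetherian.noetherian (IsLocalRing.maximalIdeal (Localization.AtPrime P)))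
  have hnum : ∀ z ∈ s, ∃ a ∈ P, ∃ t : P.primeCompl,
      z * algebraMap A (Localization.AtPrime P) t = algebraMap A _ a := by
    intro z hz
    have : z ∈ P.map (algebraMap A (Localization.AtPrime P)) := by
      rw [Localization.AtPrime.map_eq_maximalIdeal, ← hsm]
      exact Submodule.subset_span hz
    obtain ⟨⟨a, t⟩, h⟩ := (IsLocalization.mem_map_algebraMap_iff P.primeCompl _).1 this
    exact ⟨a, a.2, t, h⟩
  choose! num hnumP den hden using hnum
  -- The numerators of the generators already span `P` up to units of the local ring.
  let I : Ideal A := Ideal.span (num '' s)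
  let W : Submodule K V := Submodule.span K ((fun z => L (num z)) '' s)
  have hIW : ∀ b ∈ I, L b ∈ W ∧ ev b = 0 := by
    intro b hb
    induction hb using Submodule.span_induction with
    | mem b hb =>
      obtain ⟨z, hz, rfl⟩ := hb
      exact ⟨Submodule.subset_span ⟨z, hz, rfl⟩, hnumP z hz⟩
    | zero => simp
    | add b c _ _ hb hc => exact ⟨by rw [map_add]; exact add_mem hb.1 hc.1, by simp [hb.2, hc.2]⟩
    | smul r b _ hb =>
      rw [smul_eq_mul, hL, hb.2, zero_smul, add_zero, map_mul, hb.2, mul_zero]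
      exact ⟨W.smul_mem _ hb.1, rfl⟩
  have hImap : IsLocalRing.maximalIdeal (Localization.AtPrime P) ≤
      I.map (algebraMap A (Localization.AtPrime P)) := by
    rw [← hsm]
    refine Submodule.span_le.2 fun z hz => ?_
    exact (IsLocalization.mem_map_algebraMap_iff P.primeCompl _).2
      ⟨(⟨num z, Ideal.subset_span ⟨z, hz, rfl⟩⟩, den z), hden z hz⟩
  have hPW : ∀ a ∈ P, L a ∈ W := by
    intro a ha
    have hmem : algebraMap A (Localization.AtPrime P) a ∈
        I.map (algebraMap A (Localization.AtPrime P)) := by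
      apply hImap
      rw [← Localization.AtPrime.map_eq_maximalIdeal]
      exact Ideal.mem_map_of_mem _ ha
    obtain ⟨⟨⟨b, hb⟩, t⟩, h⟩ := (IsLocalization.mem_map_algebraMap_iff P.primeCompl _).1 hmem
    rw [← map_mul] at h
    obtain ⟨c, hc⟩ := (IsLocalization.eq_iff_exists P.primeCompl _).1 h
    have h2 := congrArg L hc
    have ha0 : ev a = 0 := ha
    simp only [hL, map_mul, (hIW b hb).2, ha0, zero_mul, zero_smul, add_zero] at h2
    have hc0 : ev c ≠ 0 := c.2
    have ht0 : ev t ≠ 0 := t.2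
    rw [zero_add, smul_smul] at h2
    rw [← inv_smul_smul₀ (mul_ne_zero hc0 ht0) (L a), h2]
    exact W.smul_mem _ (W.smul_mem _ (hIW b hb).1)
  have hW : W = ⊤ := by
    refine top_le_iff.1 (hspan.trans (Submodule.span_le.2 ?_))
    rintro _ ⟨a, ha, rfl⟩
    exact hPW a ha
  classical
  have hcard : Module.finrank K W ≤ s.card := by
    refine (finrank_span_le_card _).trans ?_
    simpa using Finset.card_image_le (s := s) (f := fun z => L (num z))
  rw [hW, finrank_top] at hcard
  omega

/-! ### The Zariski topology -/

section Zariski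

variable {K : Type*} {σ τ : Type*}

/-- The point of affine space with given coordinates. -/
def ofFun (f : σ → K) : AffSpace K σ := f

@[simp]
theorem ofFun_apply (f : σ → K) (s : σ) : ofFun f s = f s := rfl

theorem affSpace_ext {x y : AffSpace K σ} (h : ∀ s, x s = y s) : x = y := _root_.funext h

variable [Field K]

@[simp]
theorem affSpace_zero_apply (s : σ) : (0 : AffSpace K σ) s = 0 := rfl

@[simp]
theorem affSpace_add_apply (x y : AffSpace K σ) (s : σ) : (x + y) s = x s + y s := rfl

@[simp]
theorem affSpace_smul_apply (r : K) (x : AffSpace K σ) (s : σ) : (r • x) s = r * x s := rfl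

/-- Evaluation of polynomials at a point of affine space. -/
noncomputable def evalPt (x : AffSpace K σ) : MvPolynomial σ K →ₐ[K] K :=
  aeval (R := K) (show σ → K from x)

@[simp]
theorem evalPt_X (x : AffSpace K σ) (s : σ) : evalPt x (X s) = x s := aeval_X _ _

@[simp]
theorem evalPt_C (x : AffSpace K σ) (r : K) : evalPt x (C r) = r := aeval_C _ _

theorem eq_of_evalPt_eq [Infinite K] {p q : MvPolynomial σ K}
    (h : ∀ x : AffSpace K σ, evalPt x p = evalPt x q) : p = q :=
  MvPolynomial.funext fun x => by
    have := h x
    simpa [evalPt, aeval_eq_eval] using this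

/-- The zero locus of an ideal. Unlike `MvPolynomial.zeroLocus`, it is a subset of `AffSpace K σ`,
so that the Zariski topology applies to it. -/
def zeros (I : Ideal (MvPolynomial σ K)) : Set (AffSpace K σ) := zeroLocus K I

/-- The ideal of the polynomials vanishing on a subset of `AffSpace K σ`. -/
def idealOf (Z : Set (AffSpace K σ)) : Ideal (MvPolynomial σ K) :=
  vanishingIdeal K (show Set (σ → K) from Z)

theorem mem_zeros {I : Ideal (MvPolynomial σ K)} {x : AffSpace K σ} :
    x ∈ zeros I ↔ ∀ p ∈ I, evalPt x p = 0 := Iff.rfl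

theorem mem_idealOf {Z : Set (AffSpace K σ)} {p : MvPolynomial σ K} :
    p ∈ idealOf Z ↔ ∀ x ∈ Z, evalPt x p = 0 := Iff.rfl

theorem zeros_anti {I J : Ideal (MvPolynomial σ K)} (h : I ≤ J) : zeros J ⊆ zeros I :=
  zeroLocus_anti_mono h

theorem idealOf_anti {Z W : Set (AffSpace K σ)} (h : Z ⊆ W) : idealOf W ≤ idealOf Z :=
  vanishingIdeal_anti_mono h

theorem isClosed_zeros (I : Ideal (MvPolynomial σ K)) : IsClosed (zeros I) :=
  (isClosed_iff _).2 ⟨I, rfl⟩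

theorem exists_eq_zeros {Z : Set (AffSpace K σ)} (hZ : IsClosed Z) : ∃ I, Z = zeros I :=
  (isClosed_iff Z).1 hZ

theorem idealOf_zeros_of_isPrime [IsAlgClosed K] [Finite σ] (P : Ideal (MvPolynomial σ K))
    [P.IsPrime] : idealOf (zeros P) = P :=
  IsPrime.vanishingIdeal_zeroLocus P

/-- The set of points of `K^σ` where a family of polynomials vanishes is closed. -/
theorem isClosed_setOf_forall_evalPt_eq_zero {ι : Type*} (p : ι → MvPolynomial σ K) :
    IsClosed {x : AffSpace K σ | ∀ l, evalPt x (p l) = 0} := by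
  convert isClosed_zeros (Ideal.span (Set.range p)) using 1
  ext x
  refine ⟨fun h q hq => ?_, fun h l => h _ (Ideal.subset_span ⟨l, rfl⟩)⟩
  have : Ideal.span (Set.range p) ≤ RingHom.ker (evalPt x) := by
    rw [Ideal.span_le]
    rintro _ ⟨l, rfl⟩
    exact h l
  exact this hq

theorem exists_evalPt_ne_zero_of_isOpen {U : Set (AffSpace K σ)} (hU : IsOpen U)
    {x : AffSpace K σ} (hx : x ∈ U) :
    ∃ p : MvPolynomial σ K, evalPt x p ≠ 0 ∧ ∀ y, evalPt y p ≠ 0 → y ∈ U := by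
  obtain ⟨I, hI⟩ := exists_eq_zeros hU.isClosed_compl
  have hxI : x ∉ zeros I := hI ▸ fun h => h hx
  simp only [mem_zeros, not_forall] at hxI
  obtain ⟨p, hp, hpx⟩ := hxI
  refine ⟨p, hpx, fun y hy => ?_⟩
  by_contra hyU
  have : y ∈ zeros I := hI ▸ hyU
  exact hy (this p hp)

theorem zeros_idealOf_of_isClosed {Z : Set (AffSpace K σ)} (hZ : IsClosed Z) :
    zeros (idealOf Z) = Z := by
  obtain ⟨I, rfl⟩ := exists_eq_zeros hZ
  exact Set.Subset.antisymm
    (zeros_anti (le_vanishingIdeal_zeroLocus I)) (zeroLocus_vanishingIdeal_le _)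

theorem isIrreducible_of_isPrime {Z : Set (AffSpace K σ)}
    (hZ : (idealOf Z).IsPrime) : IsIrreducible Z := by
  constructor
  · by_contra h
    rw [Set.not_nonempty_iff_eq_empty] at h
    subst h
    exact hZ.ne_top (vanishingIdeal_empty (k := K) (K := K))
  · rintro U V hU hV ⟨x, hxZ, hxU⟩ ⟨y, hyZ, hyV⟩
    obtain ⟨p, hpx, hp⟩ := exists_evalPt_ne_zero_of_isOpen hU hxU
    obtain ⟨q, hqy, hq⟩ := exists_evalPt_ne_zero_of_isOpen hV hyV
    have hpq : p * q ∉ idealOf Z := fun h =>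
      (hZ.mem_or_mem h).elim (fun h => hpx (h x hxZ)) (fun h => hqy (h y hyZ))
    simp only [mem_idealOf, not_forall] at hpq
    obtain ⟨z, hz, hpqz⟩ := hpq
    rw [map_mul] at hpqz
    exact ⟨z, hz, hp z (left_ne_zero_of_mul hpqz), hq z (right_ne_zero_of_mul hpqz)⟩

theorem isOpen_setOf_evalPt_ne_zero (p : MvPolynomial σ K) :
    IsOpen {x : AffSpace K σ | evalPt x p ≠ 0} := by
  have h := (isClosed_setOf_forall_evalPt_eq_zero (fun _ : Unit => p)).isOpen_compl
  convert h using 1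
  ext x
  simp

theorem idealOf_isPrime_of_isIrreducible {Z : Set (AffSpace K σ)} (hZ : IsIrreducible Z) :
    (idealOf Z).IsPrime := by
  obtain ⟨z, hz⟩ := hZ.1
  refine ⟨fun h => ?_, fun {p q} hpq => ?_⟩
  · have h1 : (1 : MvPolynomial σ K) ∈ idealOf Z := h ▸ Submodule.mem_top
    simpa using h1 z hz
  · by_contra! h
    simp only [mem_idealOf, not_forall] at h
    obtain ⟨⟨x, hx, hpx⟩, ⟨y, hy, hqy⟩⟩ := h
    obtain ⟨w, hw, hpw, hqw⟩ := hZ.2 _ _ (isOpen_setOf_evalPt_ne_zero p)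
      (isOpen_setOf_evalPt_ne_zero q) ⟨x, hx, hpx⟩ ⟨y, hy, hqy⟩
    have := hpq w hw
    rw [map_mul] at this
    exact mul_ne_zero hpw hqw this

theorem isIrreducible_of_image_val {T : Type*} [TopologicalSpace T] {X : Set T} {Z : Set X}
    (h : IsIrreducible (Subtype.val '' Z)) : IsIrreducible Z := by
  refine ⟨Set.image_nonempty.1 h.1, ?_⟩
  rintro U V hU hV ⟨x, hxZ, hxU⟩ ⟨y, hyZ, hyV⟩
  obtain ⟨U', hU', rfl⟩ := isOpen_induced_iff.1 hU
  obtain ⟨V', hV', rfl⟩ := isOpen_induced_iff.1 hV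
  obtain ⟨_, ⟨z, hz, rfl⟩, hzU, hzV⟩ := h.2 U' V' hU' hV' ⟨x, ⟨x, hxZ, rfl⟩, hxU⟩
    ⟨y, ⟨y, hyZ, rfl⟩, hyV⟩
  exact ⟨z, hz, hzU, hzV⟩

/-- The dimension of an algebraic set is the dimension of its coordinate ring: by the
Nullstellensatz, irreducible closed subsets correspond to primes containing the vanishing ideal. -/
theorem topologicalKrullDim_eq_ringKrullDim_coordRing [IsAlgClosed K] [Finite σ]
    {X : Set (AffSpace K σ)} (hX : IsClosed X) :
    topologicalKrullDim X = ringKrullDim (CoordRing X) := by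
  rw [ringKrullDim_quotient, topologicalKrullDim]
  change _ = Order.krullDim (PrimeSpectrum.zeroLocus (idealOf X : Set (MvPolynomial σ K)))
  have hcl : ∀ Z : TopologicalSpace.IrreducibleCloseds X,
      IsClosed (Subtype.val '' (Z : Set X) : Set (AffSpace K σ)) := fun Z =>
    (hX.isClosedEmbedding_subtypeVal.isClosedMap) _ Z.isClosed'
  have hirr : ∀ Z : TopologicalSpace.IrreducibleCloseds X,
      IsIrreducible (Subtype.val '' (Z : Set X) : Set (AffSpace K σ)) := fun Z =>
    Z.isIrreducible'.image _ continuous_subtype_val.continuousOn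
  apply le_antisymm
  · rw [← Order.krullDim_orderDual (α := PrimeSpectrum.zeroLocus _)]
    let f : TopologicalSpace.IrreducibleCloseds X →
        (PrimeSpectrum.zeroLocus (idealOf X :
          Set (MvPolynomial σ K)))ᵒᵈ := fun Z =>
      OrderDual.toDual ⟨⟨idealOf (Subtype.val '' (Z : Set X) : Set (AffSpace K σ)),
        idealOf_isPrime_of_isIrreducible (hirr Z)⟩, by
          apply idealOf_anti
          rintro _ ⟨x, -, rfl⟩
          exact x.2⟩
    have hmono : Monotone f := fun Z Z' h =>
      idealOf_anti (Set.image_mono (show (Z : Set X) ⊆ Z' from h))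
    have hinj : Function.Injective f := by
      intro Z Z' h
      have h1 : idealOf (Subtype.val '' (Z : Set X) : Set (AffSpace K σ)) =
          idealOf (Subtype.val '' (Z' : Set X) : Set (AffSpace K σ)) :=
        congrArg (fun P => (OrderDual.ofDual P).1.asIdeal) h
      have h2 := congrArg zeros h1
      rw [zeros_idealOf_of_isClosed (hcl Z),
        zeros_idealOf_of_isClosed (hcl Z')] at h2
      exact SetLike.coe_injective (Subtype.val_injective.image_injective h2)
    exact Order.krullDim_le_of_strictMono f (hmono.strictMono_of_injective hinj)
  · rw [← Order.krullDim_orderDual (α := TopologicalSpace.IrreducibleCloseds X)]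
    have himg : ∀ P : PrimeSpectrum.zeroLocus (idealOf X :
          Set (MvPolynomial σ K)),
        (Subtype.val '' (Subtype.val ⁻¹' zeros P.1.asIdeal : Set X) : Set (AffSpace K σ)) =
          zeros P.1.asIdeal := by
      intro P
      rw [Subtype.image_preimage_coe, Set.inter_eq_right]
      intro x hx
      rw [← zeros_idealOf_of_isClosed hX]
      exact zeros_anti P.2 hx
    let g : PrimeSpectrum.zeroLocus (idealOf X :
          Set (MvPolynomial σ K)) → (TopologicalSpace.IrreducibleCloseds X)ᵒᵈ := fun P =>
      OrderDual.toDual ⟨Subtype.val ⁻¹' (zeros P.1.asIdeal), by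
        apply isIrreducible_of_image_val
        rw [himg]
        apply isIrreducible_of_isPrime
        rw [idealOf_zeros_of_isPrime]
        exact P.1.2,
        (isClosed_zeros _).preimage continuous_subtype_val⟩
    have hmono : Monotone g := fun P Q h =>
      (Set.preimage_mono (zeros_anti h) : (Subtype.val ⁻¹' zeros Q.1.asIdeal : Set X) ⊆ _)
    have hinj : Function.Injective g := by
      intro P Q h
      have h1 : (Subtype.val ⁻¹' (zeros P.1.asIdeal) : Set X) =
          Subtype.val ⁻¹' (zeros Q.1.asIdeal) :=
        congrArg (fun Z => ((OrderDual.ofDual Z).carrier : Set X)) h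
      have h2 := congrArg (fun Z : Set X => (Subtype.val '' Z : Set (AffSpace K σ))) h1
      simp only [himg] at h2
      have h3 := congrArg idealOf h2
      rw [idealOf_zeros_of_isPrime, idealOf_zeros_of_isPrime] at h3
      exact Subtype.ext (PrimeSpectrum.ext h3)
    exact Order.krullDim_le_of_strictMono g (hmono.strictMono_of_injective hinj)

/-- The map of affine spaces given by a family of polynomials. -/
noncomputable def polyMap (p : τ → MvPolynomial σ K) (x : AffSpace K σ) : AffSpace K τ :=
  fun t => evalPt x (p t)

theorem evalPt_polyMap (p : τ → MvPolynomial σ K) (x : AffSpace K σ) (q : MvPolynomial τ K) :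
    evalPt (polyMap p x) q = evalPt x (bind₁ p q) :=
  (aeval_bind₁ _ _ _).symm

theorem continuous_polyMap (p : τ → MvPolynomial σ K) : Continuous (polyMap p) := by
  refine continuous_iff_isClosed.2 fun Z hZ => ?_
  obtain ⟨I, rfl⟩ := exists_eq_zeros hZ
  convert isClosed_setOf_forall_evalPt_eq_zero (fun q : I => bind₁ p q.1) using 1
  ext x
  simp only [Set.mem_preimage, mem_zeros, evalPt_polyMap, Set.mem_ofPred_eq, Subtype.forall]

theorem isIrreducible_univ_affSpace [Infinite K] :
    IsIrreducible (Set.univ : Set (AffSpace K σ)) := by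
  apply isIrreducible_of_isPrime
  have : idealOf (Set.univ : Set (AffSpace K σ)) = ⊥ :=
    eq_bot_iff.2 fun p hp => eq_of_evalPt_eq fun x => by rw [mem_idealOf.1 hp x trivial, map_zero]
  exact this ▸ Ideal.isPrime_bot

/-- A subset of affine space with a polynomial parametrization is irreducible. -/
theorem isIrreducible_of_parametrization [Infinite K] (p : τ → MvPolynomial σ K)
    {Z : Set (AffSpace K τ)} (hZ : ∀ y, y ∈ Z ↔ ∃ x, polyMap p x = y) : IsIrreducible Z := by
  have h := isIrreducible_univ_affSpace.image _ (continuous_polyMap p).continuousOn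
  convert h using 1
  ext y
  rw [hZ, Set.image_univ, Set.mem_range]

end Zariski

/-! ### Singular points and isolated singularities -/

section Singular

variable {K : Type*} [Field K] {σ τ : Type*}

/-- The regular function on `X` given by a polynomial. -/
noncomputable def coordMk (X : Set (AffSpace K σ)) : MvPolynomial σ K →ₐ[K] CoordRing X :=
  Ideal.Quotient.mkₐ K _

theorem coordMk_surjective (X : Set (AffSpace K σ)) : Function.Surjective (coordMk X) :=
  Ideal.Quotient.mk_surjective

theorem coordMk_eq_zero_iff {X : Set (AffSpace K σ)} {p : MvPolynomial σ K} :
    coordMk X p = 0 ↔ p ∈ idealOf X :=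
  Ideal.Quotient.eq_zero_iff_mem

theorem coordMk_eq_iff {X : Set (AffSpace K σ)} {p q : MvPolynomial σ K} :
    coordMk X p = coordMk X q ↔ ∀ x ∈ X, evalPt x p = evalPt x q := by
  rw [← sub_eq_zero, ← map_sub, coordMk_eq_zero_iff, mem_idealOf]
  simp only [map_sub, sub_eq_zero]

theorem evalAt_coordMk (X : Set (AffSpace K σ)) (x : X) (p : MvPolynomial σ K) :
    evalAt X x (coordMk X p) = evalPt x.1 p := rfl

theorem isDomain_coordRing {X : Set (AffSpace K σ)} (hX : IsIrreducible X) :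
    IsDomain (CoordRing X) :=
  (Ideal.Quotient.isDomain_iff_prime _).2 (idealOf_isPrime_of_isIrreducible hX)

instance finiteType_coordRing [Finite σ] (X : Set (AffSpace K σ)) :
    Algebra.FiniteType K (CoordRing X) :=
  Algebra.FiniteType.of_surjective (coordMk X) (coordMk_surjective X)

/-- The coordinate functions on the line `t ↦ x + t w`, as polynomials in `t`. -/
noncomputable def lineHom (x w : AffSpace K σ) : MvPolynomial σ K →ₐ[K] Polynomial K :=
  aeval (R := K) fun s => Polynomial.C (x s) + Polynomial.C (w s) * Polynomial.X

theorem eval_lineHom (x w : AffSpace K σ) (p : MvPolynomial σ K) (t : K) :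
    (lineHom x w p).eval t = evalPt (x + t • w) p := by
  have h2 : (Polynomial.aeval t).comp (lineHom x w) = evalPt (x + t • w) := by
    apply MvPolynomial.algHom_ext
    intro s
    rw [evalPt_X, AlgHom.comp_apply, lineHom, aeval_X]
    simp only [map_add, map_mul, Polynomial.aeval_C, Polynomial.aeval_X, Algebra.algebraMap_self,
      RingHom.id_apply]
    rw [mul_comm]
    rfl
  rw [← h2, AlgHom.comp_apply, Polynomial.coe_aeval_eq_eval]

/-- Restriction of regular functions on `X` to the line `t ↦ x + t w` inside `X`. -/
noncomputable def restrictLine [Infinite K] {X : Set (AffSpace K σ)} (x w : AffSpace K σ)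
    (h : ∀ t : K, x + t • w ∈ X) : CoordRing X →ₐ[K] Polynomial K :=
  Ideal.Quotient.liftₐ (idealOf X) (lineHom x w) fun p hp =>
    Polynomial.funext fun t => by
      rw [eval_lineHom, Polynomial.eval_zero]
      exact hp _ (h t)

theorem restrictLine_coordMk [Infinite K] {X : Set (AffSpace K σ)} (x w : AffSpace K σ)
    (h : ∀ t : K, x + t • w ∈ X) (p : MvPolynomial σ K) :
    restrictLine x w h (coordMk X p) = lineHom x w p := rfl

theorem coeff_zero_restrictLine [Infinite K] {X : Set (AffSpace K σ)} (x w : AffSpace K σ)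
    (h : ∀ t : K, x + t • w ∈ X) (hx : x ∈ X) (a : CoordRing X) :
    (restrictLine x w h a).coeff 0 = evalAt X ⟨x, hx⟩ a := by
  obtain ⟨p, rfl⟩ := coordMk_surjective X a
  rw [restrictLine_coordMk, evalAt_coordMk, Polynomial.coeff_zero_eq_eval_zero, eval_lineHom,
    zero_smul, add_zero]

/-- A point of `X` on more than `dim X` lines of `X` with independent directions is singular: the
directions of these lines are tangent vectors. -/
theorem mem_singularLocus_of_lines [Infinite K] [Finite σ] {ι : Type*} [Fintype ι]
    {X : Set (AffSpace K σ)} {x : AffSpace K σ} (hx : x ∈ X) (w : ι → AffSpace K σ)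
    (hw : LinearIndependent K w) (hline : ∀ l, ∀ t : K, x + t • w l ∈ X) {d : ℕ}
    (hd : ringKrullDim (CoordRing X) = d) (hcard : d < Fintype.card ι) : x ∈ singularLocus X := by
  refine ⟨hx, fun hreg => ?_⟩
  classical
  have := Fintype.ofFinite σ
  let L : CoordRing X →ₗ[K] (ι → K) := LinearMap.pi fun l =>
    (Polynomial.lcoeff K 1).comp (restrictLine x (w l) (hline l)).toLinearMap
  have hLapp : ∀ a l, L a l = (restrictLine x (w l) (hline l) a).coeff 1 := fun a l => rfl
  have hle := finrank_le_of_isRegularLocalRing (evalAt X ⟨x, hx⟩) (pointIdeal X ⟨x, hx⟩) rfl L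
    (fun a b => by
      ext l
      simp only [hLapp, map_mul, Pi.add_apply, Pi.smul_apply, smul_eq_mul,
        Polynomial.mul_coeff_one, coeff_zero_restrictLine x (w l) (hline l) hx]
      ring)
    (by
      -- The images of `T_s - x_s` are the columns of the matrix of directions, whose rows `w l`
      -- are independent.
      let M : Matrix ι σ K := Matrix.of fun l s => w l s
      have hM : LinearIndependent K M.row := hw
      have hrank : M.rank = Fintype.card ι := hM.rank_matrix
      rw [Matrix.rank_eq_finrank_span_cols] at hrank
      have htop : Submodule.span K (Set.range M.col) = ⊤ :=
        Submodule.eq_top_of_finrank_eq (by rw [hrank, Module.finrank_fintype_fun_eq_card])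
      rw [← htop]
      refine Submodule.span_mono ?_
      rintro _ ⟨s, rfl⟩
      refine ⟨coordMk X (MvPolynomial.X s - MvPolynomial.C (x s)), ?_, ?_⟩
      · change evalAt X ⟨x, hx⟩ _ = 0
        rw [evalAt_coordMk, map_sub, evalPt_X, evalPt_C, sub_self]
      · ext l
        rw [hLapp, restrictLine_coordMk, lineHom, map_sub, aeval_X, aeval_C]
        simp [M, Matrix.col, Polynomial.coeff_C])
    hd (hreg := hreg)
  rw [Module.finrank_fintype_fun_eq_card] at hle
  omega

/-- A line of singular points through the origin prevents it from being isolated. -/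
theorem not_isIsolatedSingularity_of_line [Infinite K] {X : Set (AffSpace K σ)}
    {x : AffSpace K σ} (hx0 : x ≠ 0) (hx : ∀ t : K, t • x ∈ singularLocus X) :
    ¬ IsIsolatedSingularity X 0 := by
  rintro ⟨U, hU, hUX⟩
  have h0 : (0 : AffSpace K σ) ∈ U := (hUX.symm.subset rfl).1
  obtain ⟨p, hp0, hp⟩ := exists_evalPt_ne_zero_of_isOpen hU h0
  have hq : ∀ t : K, (lineHom 0 x p).eval t = evalPt (t • x) p := fun t => by
    rw [eval_lineHom, zero_add]
  have hq0 : lineHom 0 x p * Polynomial.X ≠ 0 := by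
    refine mul_ne_zero (fun h => ?_) Polynomial.X_ne_zero
    have h1 := hq 0
    rw [h, Polynomial.eval_zero, zero_smul] at h1
    exact hp0 h1.symm
  obtain ⟨t, ht⟩ : ∃ t, (lineHom 0 x p * Polynomial.X).eval t ≠ 0 := by
    by_contra! h
    exact hq0 (Polynomial.funext fun t => by rw [h t, Polynomial.eval_zero])
  rw [Polynomial.eval_mul, Polynomial.eval_X, hq] at ht
  have : t • x ∈ ({0} : Set (AffSpace K σ)) := hUX ▸ ⟨hp _ (left_ne_zero_of_mul ht), hx t⟩
  exact (smul_ne_zero (right_ne_zero_of_mul ht) hx0) this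

/-- The coordinate functions indexed by `ι`, as a map to the coordinate ring of `X`. -/
noncomputable def chartHom {ι : Type*} (X : Set (AffSpace K σ)) (c : ι → σ) :
    MvPolynomial ι K →ₐ[K] CoordRing X :=
  (coordMk X).comp (rename c)

theorem evalPt_rename {ι : Type*} {c : ι → σ} {y : AffSpace K σ} {a : AffSpace K ι}
    (h : ∀ l, y (c l) = a l) (p : MvPolynomial ι K) : evalPt y (rename c p) = evalPt a p := by
  have : (evalPt y).comp (rename c) = evalPt a := by
    apply MvPolynomial.algHom_ext
    intro l
    rw [AlgHom.comp_apply, rename_X, evalPt_X, evalPt_X, h]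
  rw [← this, AlgHom.comp_apply]

/-- If every point of a principal open set of `K^ι` extends to a point of `X`, then the
coordinates indexed by `ι` are algebraically independent on `X`. -/
theorem chartHom_injective [Infinite K] {ι : Type*} {X : Set (AffSpace K σ)} {c : ι → σ}
    {h : MvPolynomial ι K} (h0 : h ≠ 0)
    (hX : ∀ a : AffSpace K ι, evalPt a h ≠ 0 → ∃ y ∈ X, ∀ l, y (c l) = a l) :
    Function.Injective (chartHom X c) := by
  refine (injective_iff_map_eq_zero _).2 fun p hp => ?_
  rw [chartHom, AlgHom.comp_apply, coordMk_eq_zero_iff] at hp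
  have hph : p * h = 0 := by
    refine eq_of_evalPt_eq fun a => ?_
    rw [map_mul, map_zero]
    by_cases ha : evalPt a h = 0
    · rw [ha, mul_zero]
    · obtain ⟨y, hy, hya⟩ := hX a ha
      rw [← evalPt_rename hya, mem_idealOf.1 hp y hy, zero_mul]
  exact (mul_eq_zero.1 hph).resolve_right h0

theorem fractionSubalgebra_chartHom_eq_top {ι : Type*} {X : Set (AffSpace K σ)} {c : ι → σ}
    {P : Ideal (CoordRing X)} [P.IsPrime]
    (h : ∀ s, coordMk X (MvPolynomial.X s) ∈ fractionSubalgebra (chartHom X c) P) :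
    fractionSubalgebra (chartHom X c) P = ⊤ := by
  refine eq_top_iff.2 fun a _ => ?_
  obtain ⟨p, rfl⟩ := coordMk_surjective X a
  induction p using MvPolynomial.induction_on with
  | C r => exact Subalgebra.algebraMap_mem _ r
  | add p q hp hq => rw [map_add]; exact add_mem (hp trivial) (hq trivial)
  | mul_X p s hp => rw [map_mul]; exact mul_mem (hp trivial) (h s)

end Singular

/-! ### Renaming coordinates, components of a union -/

section Transport

variable {K : Type*} [Field K] {σ τ : Type*}

/-- A renaming of the coordinates carries singular points to singular points. -/
theorem mem_singularLocus_of_equiv (e : σ ≃ τ) {X : Set (AffSpace K σ)}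
    {Y : Set (AffSpace K τ)} {x : AffSpace K σ} {y : AffSpace K τ}
    (hX : ∀ z ∈ X, ∃ z' ∈ Y, ∀ s, z' (e s) = z s) (hY : ∀ z' ∈ Y, ∃ z ∈ X, ∀ s, z' (e s) = z s)
    (hxy : ∀ s, y (e s) = x s) (hx : x ∈ singularLocus X) : y ∈ singularLocus Y := by
  obtain ⟨hxX, hreg⟩ := hx
  have hmem : ∀ p : MvPolynomial σ K, p ∈ idealOf X ↔ renameEquiv K e p ∈ idealOf Y := by
    intro p
    rw [renameEquiv_apply, mem_idealOf, mem_idealOf]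
    constructor
    · intro hp z' hz'
      obtain ⟨z, hz, h⟩ := hY z' hz'
      rw [evalPt_rename h, hp z hz]
    · intro hp z hz
      obtain ⟨z', hz', h⟩ := hX z hz
      rw [← evalPt_rename h, hp z' hz']
  have hyY : y ∈ Y := by
    obtain ⟨z', hz', h⟩ := hX x hxX
    convert hz'
    refine _root_.funext fun t => ?_
    obtain ⟨s, rfl⟩ := e.surjective t
    rw [hxy, h]
  let E : CoordRing X ≃+* CoordRing Y := Ideal.quotientEquiv (idealOf X) (idealOf Y)
    (renameEquiv K e).toRingEquiv (by
      ext q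
      obtain ⟨p, rfl⟩ := (renameEquiv K e).surjective q
      rw [← hmem]
      refine Iff.trans ?_ (Ideal.mem_map_of_equiv (renameEquiv K e).toRingEquiv _).symm
      exact ⟨fun hp => ⟨p, hp, rfl⟩, fun ⟨p', hp', h⟩ => (renameEquiv K e).injective h ▸ hp'⟩)
  have hE : ∀ a, evalAt Y ⟨y, hyY⟩ (E a) = evalAt X ⟨x, hxX⟩ a := by
    intro a
    obtain ⟨p, rfl⟩ := coordMk_surjective X a
    exact evalPt_rename hxy p
  refine ⟨hyY, fun hreg' => hreg ?_⟩
  have hM : (pointIdeal Y ⟨y, hyY⟩).primeCompl.map E.symm.toMonoidHom =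
      (pointIdeal X ⟨x, hxX⟩).primeCompl := by
    ext a
    constructor
    · rintro ⟨b, hb, rfl⟩ h0
      refine hb ?_
      have := hE (E.symm b)
      rw [E.apply_symm_apply] at this
      exact this.trans h0
    · intro ha
      exact ⟨E a, fun h0 => ha ((hE a).symm.trans h0), E.symm_apply_apply a⟩
  exact @IsRegularLocalRing.of_ringEquiv _ _ hreg' _ _
    (IsLocalization.ringEquivOfRingEquiv (LocalRingAt Y ⟨y, hyY⟩) (LocalRingAt X ⟨x, hxX⟩)
      E.symm hM)

/-- Two incomparable irreducible closed sets are the irreducible components of their union. -/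
theorem componentsOf_union {A B : Set (AffSpace K σ)} (hA : IsClosed A) (hB : IsClosed B)
    (hAi : IsIrreducible A) (hBi : IsIrreducible B) (hAB : ¬ A ⊆ B) (hBA : ¬ B ⊆ A) :
    componentsOf (A ∪ B) = {A, B} := by
  have himg : ∀ C : Set (AffSpace K σ), C ⊆ A ∪ B →
      (Subtype.val '' (Subtype.val ⁻¹' C : Set ↥(A ∪ B)) : Set (AffSpace K σ)) = C := by
    intro C hC
    rw [Subtype.image_preimage_coe, Set.inter_eq_right]
    exact hC
  have hsub : ∀ S : Set ↥(A ∪ B), IsIrreducible S →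
      Subtype.val '' S ⊆ A ∨ Subtype.val '' S ⊆ B := by
    intro S hS
    have h := (hS.image _ continuous_subtype_val.continuousOn).2
    refine isPreirreducible_iff_isClosed_union_isClosed.1 h A B hA hB ?_
    rintro _ ⟨z, -, rfl⟩
    exact z.2
  have hmax : ∀ {C D : Set (AffSpace K σ)}, C ⊆ A ∪ B → IsIrreducible C → ¬ C ⊆ D →
      (∀ S : Set ↥(A ∪ B), IsIrreducible S → Subtype.val '' S ⊆ C ∨ Subtype.val '' S ⊆ D) →
      C ∈ componentsOf (A ∪ B) := by
    intro C D hC hCi hCD hS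
    refine ⟨Subtype.val ⁻¹' C, ⟨isIrreducible_of_image_val ?_, fun S hSi hle => ?_⟩, himg C hC⟩
    · rwa [himg C hC]
    · have h1 : C ⊆ Subtype.val '' S := by
        rw [← himg C hC]
        exact Set.image_mono hle
      exact Set.image_subset_iff.1 ((hS S hSi).resolve_right fun h => hCD (h1.trans h))
  refine Set.Subset.antisymm ?_ ?_
  · rintro _ ⟨S, hS, rfl⟩
    have hle : ∀ C : Set (AffSpace K σ), C ⊆ A ∪ B → IsIrreducible C → Subtype.val '' S ⊆ C →
        Subtype.val '' S = C := by
      intro C hC hCi hSC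
      refine hSC.antisymm ?_
      have hi : IsIrreducible (Subtype.val ⁻¹' C : Set ↥(A ∪ B)) := by
        apply isIrreducible_of_image_val
        rwa [himg C hC]
      rw [← himg C hC]
      exact Set.image_mono (hS.2 hi (Set.image_subset_iff.1 hSC))
    exact (hsub S hS.1).imp (hle A Set.subset_union_left hAi) (hle B Set.subset_union_right hBi)
  · rintro C (rfl | rfl)
    · exact hmax Set.subset_union_left hAi hAB hsub
    · exact hmax Set.subset_union_right hBi hBA fun S hS => (hsub S hS).symm

end Transport

/-! ### Matrices of rank at most one and pairs of them -/

section Pairs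

variable {K : Type*} [Field K] {i j k m n : ℕ}

theorem mem_rankLeOne_iff_exists {x : AffSpace K (Fin m × Fin n)} :
    x ∈ rankLeOne K m n ↔ ∃ (u : Fin m → K) (v : Fin n → K), ∀ a b, x (a, b) = u a * v b := by
  constructor
  · intro h
    have h' : (toMat x).rank ≤ 1 := h
    rw [Matrix.rank_eq_finrank_span_cols, finrank_le_one_iff] at h'
    obtain ⟨⟨u, hu⟩, h'⟩ := h'
    choose v hv using fun b => h' ⟨(toMat x).col b, Submodule.subset_span ⟨b, rfl⟩⟩
    refine ⟨u, v, fun a b => ?_⟩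
    have := congrFun (congrArg Subtype.val (hv b)) a
    simp only [SetLike.mk_smul_mk, Pi.smul_apply, smul_eq_mul] at this
    rw [mul_comm, this]
    rfl
  · rintro ⟨u, v, h⟩
    have : toMat x = Matrix.vecMulVec u v := by
      ext a b
      exact h a b
    change (toMat x).rank ≤ 1
    rw [this]
    exact Matrix.rank_vecMulVec_le u v

/-- A matrix has rank at most one if and only if its `2 × 2` minors vanish. -/
theorem mem_rankLeOne_iff_minors {x : AffSpace K (Fin m × Fin n)} :
    x ∈ rankLeOne K m n ↔ ∀ a a' b b', x (a, b) * x (a', b') = x (a, b') * x (a', b) := by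
  rw [mem_rankLeOne_iff_exists]
  constructor
  · rintro ⟨u, v, h⟩ a a' b b'
    rw [h, h, h, h]
    ring
  · intro h
    by_cases h0 : ∀ s, x s = 0
    · exact ⟨0, 0, fun a b => by rw [h0]; simp⟩
    · push Not at h0
      obtain ⟨⟨a', b'⟩, h0⟩ := h0
      refine ⟨fun a => x (a, b'), fun b => x (a', b) / x (a', b'), fun a b => ?_⟩
      rw [mul_div_assoc', eq_div_iff h0]
      exact h _ _ _ _

theorem mem_pairVariety_iff {x : AffSpace K ((Fin j × Fin k) ⊕ (Fin i × Fin j))} :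
    x ∈ pairVariety K i j k ↔ fstPart x ∈ rankLeOne K j k ∧ sndPart x ∈ rankLeOne K i j ∧
      ∀ r d, ∑ c, x (Sum.inr (r, c)) * x (Sum.inl (c, d)) = 0 := by
  have : (toMat (sndPart x) * toMat (fstPart x) = 0) ↔
      ∀ r d, ∑ c, x (Sum.inr (r, c)) * x (Sum.inl (c, d)) = 0 := by
    rw [← Matrix.ext_iff]
    rfl
  rw [← this, ← and_assoc]
  rfl

theorem mem_pairVariety_of_eq {x : AffSpace K ((Fin j × Fin k) ⊕ (Fin i × Fin j))}
    (u : Fin j → K) (v : Fin k → K) (w : Fin i → K) (z : Fin j → K) (hzu : ∑ c, z c * u c = 0)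
    (hM : ∀ c d, x (Sum.inl (c, d)) = u c * v d) (hN : ∀ r c, x (Sum.inr (r, c)) = w r * z c) :
    x ∈ pairVariety K i j k := by
  refine mem_pairVariety_iff.2 ⟨mem_rankLeOne_iff_exists.2 ⟨u, v, hM⟩,
    mem_rankLeOne_iff_exists.2 ⟨w, z, hN⟩, fun r d => ?_⟩
  calc ∑ c, x (Sum.inr (r, c)) * x (Sum.inl (c, d)) = ∑ c, w r * v d * (z c * u c) :=
        Finset.sum_congr rfl fun c _ => by rw [hM, hN]; ring
    _ = 0 := by rw [← Finset.mul_sum, hzu, mul_zero]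

theorem exists_eq_of_mem_pairVariety {x : AffSpace K ((Fin j × Fin k) ⊕ (Fin i × Fin j))}
    (hx : x ∈ pairVariety K i j k) :
    ∃ (u : Fin j → K) (v : Fin k → K) (w : Fin i → K) (z : Fin j → K), ∑ c, z c * u c = 0 ∧
      (∀ c d, x (Sum.inl (c, d)) = u c * v d) ∧ ∀ r c, x (Sum.inr (r, c)) = w r * z c := by
  obtain ⟨hM, hN, h⟩ := mem_pairVariety_iff.1 hx
  obtain ⟨u, v, hM⟩ := mem_rankLeOne_iff_exists.1 hM
  obtain ⟨w, z, hN⟩ := mem_rankLeOne_iff_exists.1 hN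
  replace hM : ∀ c d, x (Sum.inl (c, d)) = u c * v d := hM
  replace hN : ∀ r c, x (Sum.inr (r, c)) = w r * z c := hN
  by_cases hzu : ∑ c, z c * u c = 0
  · exact ⟨u, v, w, z, hzu, hM, hN⟩
  have hwv : ∀ r d, w r * v d = 0 := by
    intro r d
    have h1 : ∑ c, x (Sum.inr (r, c)) * x (Sum.inl (c, d)) = w r * v d * ∑ c, z c * u c := by
      rw [Finset.mul_sum]
      exact Finset.sum_congr rfl fun c _ => by rw [hM, hN]; ring
    rw [h] at h1
    exact (mul_eq_zero.1 h1.symm).resolve_right hzu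
  -- One of the two matrices vanishes, so its factors may be replaced by zero.
  by_cases hv : ∀ d, v d = 0
  · exact ⟨0, 0, w, z, by simp, fun c d => by rw [hM, hv]; simp, hN⟩
  · push Not at hv
    obtain ⟨d, hd⟩ := hv
    have hw : ∀ r, w r = 0 := fun r => (mul_eq_zero.1 (hwv r d)).resolve_right hd
    exact ⟨u, v, 0, 0, by simp, hM, fun r c => by rw [hN, hw]; simp⟩

theorem eq_zero_of_fstPart_sndPart {σ τ : Type*} {x : AffSpace K (σ ⊕ τ)} (h1 : fstPart x = 0)
    (h2 : sndPart x = 0) : x = 0 := by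
  refine affSpace_ext fun s => ?_
  rcases s with s | t
  · exact congrFun h1 s
  · exact congrFun h2 t

/-- The parametrization `(B, u, v, w) ↦ (u vᵀ, w ((B - Bᵀ) u)ᵀ)` of the variety of pairs. -/
noncomputable def pairParam (K : Type*) [Field K] (i j k : ℕ) :
    (Fin j × Fin k) ⊕ (Fin i × Fin j) →
      MvPolynomial ((Fin j × Fin j) ⊕ Fin j ⊕ Fin k ⊕ Fin i) K
  | Sum.inl (c, d) => X (.inr (.inl c)) * X (.inr (.inr (.inl d)))
  | Sum.inr (r, c) => X (.inr (.inr (.inr r))) *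
      ∑ c', (X (.inl (c, c')) - X (.inl (c', c))) * X (.inr (.inl c'))

/-- The variety of pairs is a polynomial image of an affine space: if `z` is orthogonal to `u ≠ 0`,
then `z = (B - Bᵀ) u` for some matrix `B`. -/
theorem mem_pairVariety_iff_exists_pairParam (hj : 2 ≤ j)
    (x : AffSpace K ((Fin j × Fin k) ⊕ (Fin i × Fin j))) :
    x ∈ pairVariety K i j k ↔ ∃ y, polyMap (pairParam K i j k) y = x := by
  constructor
  · intro hx
    obtain ⟨u, v, w, z, hu, hzu, hM, hN⟩ : ∃ (u : Fin j → K) (v : Fin k → K) (w : Fin i → K)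
        (z : Fin j → K), u ≠ 0 ∧ ∑ c, z c * u c = 0 ∧
          (∀ c d, x (Sum.inl (c, d)) = u c * v d) ∧ ∀ r c, x (Sum.inr (r, c)) = w r * z c := by
      obtain ⟨u, v, w, z, hzu, hM, hN⟩ := exists_eq_of_mem_pairVariety hx
      by_cases hu : u = 0
      · -- Here the first matrix is zero, and any nonzero vector orthogonal to `z` replaces `u`.
        let c₀ : Fin j := ⟨0, by omega⟩
        let c₁ : Fin j := ⟨1, by omega⟩
        have hc : c₀ ≠ c₁ := by simp [c₀, c₁]
        by_cases hz : z c₀ = 0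
        · refine ⟨Pi.single c₀ 1, 0, w, z, by simp, ?_, fun c d => by rw [hM, hu]; simp, hN⟩
          simp [Pi.single_apply, hz]
        · refine ⟨Pi.single c₁ (z c₀) - Pi.single c₀ (z c₁), 0, w, z, fun h => hz ?_, ?_,
            fun c d => by rw [hM, hu]; simp, hN⟩
          · simpa [hc.symm] using congrFun h c₁
          · simp [Pi.single_apply, mul_sub, mul_comm]
      · exact ⟨u, v, w, z, hu, hzu, hM, hN⟩
    obtain ⟨a, ha⟩ := Function.ne_iff.1 hu
    replace ha : u a ≠ 0 := ha
    refine ⟨ofFun (Sum.elim (fun p => if p.2 = a then z p.1 / u a else 0)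
      (Sum.elim u (Sum.elim v w))), affSpace_ext fun s => ?_⟩
    rcases s with ⟨c, d⟩ | ⟨r, c⟩
    · rw [hM]
      simp [polyMap, pairParam]
    · rw [hN]
      have h1 : ∑ c', z c' / u a * u c' = 0 := by
        have : ∀ c', z c' / u a * u c' = (u a)⁻¹ * (z c' * u c') := fun c' => by ring
        simp_rw [this, ← Finset.mul_sum, hzu, mul_zero]
      by_cases hca : c = a
      · subst hca
        simp [polyMap, pairParam, sub_mul, h1, ha]
      · simp [polyMap, pairParam, sub_mul, hca, ha]
  · rintro ⟨y, rfl⟩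
    refine mem_pairVariety_of_eq (fun c => y (.inr (.inl c))) (fun d => y (.inr (.inr (.inl d))))
      (fun r => y (.inr (.inr (.inr r))))
      (fun c => ∑ c', (y (.inl (c, c')) - y (.inl (c', c))) * y (.inr (.inl c'))) ?_ ?_ ?_
    · -- An alternating form vanishes on `(u, u)`.
      simp only [Finset.sum_mul, sub_mul, Finset.sum_sub_distrib]
      rw [sub_eq_zero]
      rw [Finset.sum_comm]
      exact Finset.sum_congr rfl fun c _ => Finset.sum_congr rfl fun c' _ => by ring
    · intro c d
      simp [polyMap, pairParam]
    · intro r c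
      simp [polyMap, pairParam]

theorem isIrreducible_pairVariety [Infinite K] (hj : 2 ≤ j) :
    IsIrreducible (pairVariety K i j k) :=
  isIrreducible_of_parametrization _ (mem_pairVariety_iff_exists_pairParam hj)

theorem isClosed_rankLeOne : IsClosed (rankLeOne K m n) := by
  convert isClosed_setOf_forall_evalPt_eq_zero (K := K) (σ := Fin m × Fin n)
    (fun l : (Fin m × Fin m) × (Fin n × Fin n) =>
      X (l.1.1, l.2.1) * X (l.1.2, l.2.2) - X (l.1.1, l.2.2) * X (l.1.2, l.2.1)) using 1
  ext x
  simp [mem_rankLeOne_iff_minors, sub_eq_zero]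

theorem continuous_fstPart {σ τ : Type*} : Continuous (fstPart : AffSpace K (σ ⊕ τ) → _) := by
  convert continuous_polyMap (K := K) fun s : σ => X (Sum.inl s : σ ⊕ τ) using 1
  refine _root_.funext fun x => affSpace_ext fun s => ?_
  simp [polyMap, fstPart]

theorem continuous_sndPart {σ τ : Type*} : Continuous (sndPart : AffSpace K (σ ⊕ τ) → _) := by
  convert continuous_polyMap (K := K) fun s : τ => X (Sum.inr s : σ ⊕ τ) using 1
  refine _root_.funext fun x => affSpace_ext fun s => ?_
  simp [polyMap, sndPart]

theorem isClosed_prodSet {σ τ : Type*} {A : Set (AffSpace K σ)} {B : Set (AffSpace K τ)}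
    (hA : IsClosed A) (hB : IsClosed B) : IsClosed (prodSet A B) :=
  (hA.preimage continuous_fstPart).inter (hB.preimage continuous_sndPart)

theorem isClosed_singleton_zero {σ : Type*} : IsClosed ({0} : Set (AffSpace K σ)) := by
  convert isClosed_setOf_forall_evalPt_eq_zero (K := K) (σ := σ) X using 1
  ext x
  simp only [evalPt_X]
  exact ⟨fun h s => congrFun h s, fun h => _root_.funext h⟩

theorem isClosed_pairVariety : IsClosed (pairVariety K i j k) := by
  refine (isClosed_prodSet isClosed_rankLeOne isClosed_rankLeOne).inter
    (s₂ := {x | toMat (sndPart x) * toMat (fstPart x) = 0}) ?_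
  convert isClosed_setOf_forall_evalPt_eq_zero (K := K)
    (σ := (Fin j × Fin k) ⊕ (Fin i × Fin j)) (fun l : Fin i × Fin k =>
      ∑ c, X (Sum.inr (l.1, c)) * X (Sum.inl (c, l.2))) using 1
  ext x
  simp only [map_sum, map_mul, evalPt_X, Prod.forall]
  exact Matrix.ext_iff.symm

theorem isIrreducible_prodSet_rankLeOne_zero [Infinite K] {τ : Type*} :
    IsIrreducible (prodSet (rankLeOne K m n) ({0} : Set (AffSpace K τ))) := by
  refine isIrreducible_of_parametrization (σ := Fin m ⊕ Fin n)
    (Sum.elim (fun p => X (.inl p.1) * X (.inr p.2)) 0) fun x => ?_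
  constructor
  · rintro ⟨h1, h2⟩
    obtain ⟨u, v, h⟩ := mem_rankLeOne_iff_exists.1 h1
    refine ⟨ofFun (Sum.elim u v), affSpace_ext fun s => ?_⟩
    rcases s with ⟨c, d⟩ | t
    · have : x (.inl (c, d)) = u c * v d := h c d
      simp [polyMap, this]
    · have : x (.inr t) = 0 := congrFun h2 t
      simp [polyMap, this]
  · rintro ⟨y, rfl⟩
    refine ⟨mem_rankLeOne_iff_exists.2
      ⟨fun c => y (.inl c), fun d => y (.inr d), fun c d => ?_⟩, affSpace_ext fun t => ?_⟩
    · simp [polyMap, fstPart]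
    · simp only [sndPart, polyMap, Sum.elim_inr, Pi.zero_apply, map_zero, affSpace_zero_apply]

theorem isIrreducible_prodSet_zero_rankLeOne [Infinite K] {σ : Type*} :
    IsIrreducible (prodSet ({0} : Set (AffSpace K σ)) (rankLeOne K m n)) := by
  refine isIrreducible_of_parametrization (σ := Fin m ⊕ Fin n)
    (Sum.elim 0 (fun p => X (.inl p.1) * X (.inr p.2))) fun x => ?_
  constructor
  · rintro ⟨h1, h2⟩
    obtain ⟨u, v, h⟩ := mem_rankLeOne_iff_exists.1 h2
    refine ⟨ofFun (Sum.elim u v), affSpace_ext fun s => ?_⟩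
    rcases s with t | ⟨c, d⟩
    · have : x (.inl t) = 0 := congrFun h1 t
      simp [polyMap, this]
    · have : x (.inr (c, d)) = u c * v d := h c d
      simp [polyMap, this]
  · rintro ⟨y, rfl⟩
    refine ⟨affSpace_ext fun t => ?_, mem_rankLeOne_iff_exists.2
      ⟨fun c => y (.inl c), fun d => y (.inr d), fun c d => ?_⟩⟩
    · simp only [fstPart, polyMap, Sum.elim_inl, Pi.zero_apply, map_zero, affSpace_zero_apply]
    · simp [polyMap, sndPart]

end Pairs

/-! ### Charts at the smooth points -/

section Charts

variable {K : Type*} [Field K] {i j k : ℕ}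

/-- The index set of the chart below: `c' ≠ a`, then `d`, then `c' ≠ a`, then `r ≠ e`. -/
abbrev ChartIndex (k : ℕ) (a : Fin j) (e : Fin i) : Type :=
  {c' : Fin j // c' ≠ a} ⊕ Fin k ⊕ {c' : Fin j // c' ≠ a} ⊕ {r : Fin i // r ≠ e}

/-- The coordinates of a chart of the variety of pairs `(M, N)` near a point with `M a b ≠ 0`:
column `b` and row `a` of `M`, and row `e` and column `c` of the matrix obtained from `N` by
deleting column `a`. -/
def chartCoord (a : Fin j) (b : Fin k) (e : Fin i) (c : Fin j) :
    ChartIndex k a e → (Fin j × Fin k) ⊕ (Fin i × Fin j)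
  | .inl c' => .inl (c', b)
  | .inr (.inl d) => .inl (a, d)
  | .inr (.inr (.inl c')) => .inr (e, c')
  | .inr (.inr (.inr r)) => .inr (r, c)

theorem card_chartIndex (hj : 2 ≤ j) (a : Fin j) (e : Fin i) :
    Fintype.card (ChartIndex k a e) = 2 * j + i + k - 3 := by
  have := e.pos
  simp only [Fintype.card_sum, Fintype.card_fin, ne_eq, Fintype.card_subtype_compl,
    Fintype.card_unique]
  omega

/-- The chart coordinates may be prescribed freely as long as `M a b` and `N e c` are nonzero. -/
theorem chartHom_chartCoord_injective [Infinite K] (a : Fin j) (b : Fin k) (e : Fin i)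
    {c : Fin j} (hca : c ≠ a) :
    Function.Injective (chartHom (pairVariety K i j k) (chartCoord a b e c)) := by
  classical
  refine chartHom_injective (h := X (.inr (.inl b)) * X (.inr (.inr (.inl ⟨c, hca⟩))))
    (mul_ne_zero (X_ne_zero _) (X_ne_zero _)) fun y hy => ?_
  rw [map_mul, evalPt_X, evalPt_X] at hy
  have hα := left_ne_zero_of_mul hy
  have hβ := right_ne_zero_of_mul hy
  set α := y (.inr (.inl b))
  set β := y (.inr (.inr (.inl ⟨c, hca⟩)))
  let u : Fin j → K := fun c' => if h : c' = a then 1 else y (.inl ⟨c', h⟩) / α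
  let v : Fin k → K := fun d => y (.inr (.inl d))
  let w : Fin i → K := fun r => if h : r = e then 1 else y (.inr (.inr (.inr ⟨r, h⟩))) / β
  let z : Fin j → K := fun c' => if h : c' = a then
    -∑ c'' : {c'' : Fin j // c'' ≠ a}, y (.inr (.inr (.inl c''))) * u c''
    else y (.inr (.inr (.inl ⟨c', h⟩)))
  have hzne : ∀ c' : {c' : Fin j // c' ≠ a}, z c' = y (.inr (.inr (.inl c'))) := fun c' =>
    dif_neg c'.2
  have hza : z a = -∑ c'' : {c'' : Fin j // c'' ≠ a}, y (.inr (.inr (.inl c''))) * u c'' :=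
    dif_pos rfl
  have hua : u a = 1 := dif_pos rfl
  have hwe : w e = 1 := dif_pos rfl
  refine ⟨ofFun (Sum.elim (fun p => u p.1 * v p.2) fun p => w p.1 * z p.2),
    mem_pairVariety_of_eq u v w z ?_ (fun c d => rfl) (fun r c => rfl), ?_⟩
  · rw [Fintype.sum_eq_add_sum_subtype_ne _ a, hza, hua]
    simp only [hzne]
    ring
  · rintro (c' | d | c' | r)
    · have hu : u c' = y (.inl c') / α := dif_neg c'.2
      change u c' * α = _
      rw [hu, div_mul_cancel₀ _ hα]
    · change u a * v d = _
      rw [hua, one_mul]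
    · change w e * z c' = _
      rw [hwe, hzne, one_mul]
    · have hw : w r = y (.inr (.inr (.inr r))) / β := dif_neg r.2
      change w r * z c = _
      rw [hw, hzne ⟨c, hca⟩, div_mul_cancel₀ _ hβ]

/-- Near a point with `M a b ≠ 0`, all entries are fractions in the chart coordinates, provided
that `N e c ≠ 0` or that the chart contains all entries of `N` outside column `a`. -/
theorem fractionSubalgebra_chartCoord_eq_top {x : AffSpace K ((Fin j × Fin k) ⊕ (Fin i × Fin j))}
    (hx : x ∈ pairVariety K i j k) {a : Fin j} {b : Fin k} (hM : x (.inl (a, b)) ≠ 0) {e : Fin i}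
    {c : Fin j} (hca : c ≠ a) (hN : x (.inr (e, c)) ≠ 0 ∨ i = 1 ∨ j = 2) :
    fractionSubalgebra (chartHom (pairVariety K i j k) (chartCoord a b e c))
      (pointIdeal _ ⟨x, hx⟩) = ⊤ := by
  set V := pairVariety K i j k
  set S := fractionSubalgebra (chartHom V (chartCoord a b e c)) (pointIdeal V ⟨x, hx⟩)
  let M : Fin j → Fin k → CoordRing V := fun c d => coordMk V (X (.inl (c, d)))
  let N : Fin i → Fin j → CoordRing V := fun r c => coordMk V (X (.inr (r, c)))
  have hcoord : ∀ l, coordMk V (X (chartCoord a b e c l)) ∈ S := by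
    intro l
    have := apply_mem_fractionSubalgebra (chartHom V (chartCoord a b e c))
      (pointIdeal V ⟨x, hx⟩) (X l)
    rwa [chartHom, AlgHom.comp_apply, rename_X] at this
  have hunit : ∀ s, x s ≠ 0 → coordMk V (X s) ∉ pointIdeal V ⟨x, hx⟩ := by
    intro s hs h0
    have h1 : evalAt V ⟨x, hx⟩ (coordMk V (X s)) = 0 := h0
    rw [evalAt_coordMk, evalPt_X] at h1
    exact hs h1
  have hMminor : ∀ c d, M c d * M a b = M c b * M a d := by
    intro c d
    simp only [M, ← map_mul]
    refine coordMk_eq_iff.2 fun y hy => ?_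
    simp only [map_mul, evalPt_X]
    have h := (mem_rankLeOne_iff_minors.1 (mem_pairVariety_iff.1 hy).1) c a d b
    exact h
  have hNminor : ∀ r c', N r c' * N e c = N r c * N e c' := by
    intro r c'
    simp only [N, ← map_mul]
    refine coordMk_eq_iff.2 fun y hy => ?_
    simp only [map_mul, evalPt_X]
    have h := (mem_rankLeOne_iff_minors.1 (mem_pairVariety_iff.1 hy).2.1) r e c' c
    exact h
  have hNM : ∀ r, N r a * M a b = -∑ c' : {c' : Fin j // c' ≠ a}, N r c' * M c' b := by
    intro r
    simp only [N, M, ← map_mul, ← map_sum, ← map_neg]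
    refine coordMk_eq_iff.2 fun y hy => ?_
    simp only [map_mul, map_sum, map_neg, evalPt_X]
    have h := (mem_pairVariety_iff.1 hy).2.2 r b
    rw [Fintype.sum_eq_add_sum_subtype_ne _ a] at h
    exact eq_neg_of_add_eq_zero_left h
  have hrow : ∀ d, M a d ∈ S := fun d => hcoord (.inr (.inl d))
  have hcol : ∀ c', M c' b ∈ S := by
    intro c'
    by_cases h : c' = a
    · exact h ▸ hrow b
    · exact hcoord (.inl ⟨c', h⟩)
  have hNrow : ∀ c', c' ≠ a → N e c' ∈ S := fun c' h => hcoord (.inr (.inr (.inl ⟨c', h⟩)))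
  have hNcol : ∀ r, N r c ∈ S := by
    intro r
    by_cases h : r = e
    · exact h ▸ hNrow c hca
    · exact hcoord (.inr (.inr (.inr ⟨r, h⟩)))
  have hNne : ∀ r c', c' ≠ a → N r c' ∈ S := by
    intro r c' hc'
    rcases hN with hN | rfl | rfl
    · refine mem_fractionSubalgebra_of_mul_mem (hNcol e) (hunit _ hN) ?_
      rw [hNminor]
      exact mul_mem (hNcol r) (hNrow c' hc')
    · rw [Subsingleton.elim r e]
      exact hNrow c' hc'
    · have : c' = c := by omega
      exact this ▸ hNcol r
  refine fractionSubalgebra_chartHom_eq_top ?_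
  rintro (⟨c', d⟩ | ⟨r, c'⟩)
  · refine mem_fractionSubalgebra_of_mul_mem (hrow b) (hunit _ hM) ?_
    change M c' d * M a b ∈ S
    rw [hMminor]
    exact mul_mem (hcol c') (hrow d)
  · by_cases hc' : c' = a
    · subst hc'
      refine mem_fractionSubalgebra_of_mul_mem (hrow b) (hunit _ hM) ?_
      change N r c' * M c' b ∈ S
      rw [hNM]
      exact neg_mem (sum_mem fun c'' _ => mul_mem (hNne r c'' c''.2) (hcol c''))
    · exact hNne r c' hc'

theorem ringKrullDim_coordRing_pairVariety [Infinite K] (hi : 1 ≤ i) (hj : 2 ≤ j) (hk : 1 ≤ k) :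
    ringKrullDim (CoordRing (pairVariety K i j k)) = (2 * j + i + k - 3 : ℕ) := by
  have := isDomain_coordRing (isIrreducible_pairVariety (K := K) (i := i) (k := k) hj)
  let a : Fin j := ⟨0, by omega⟩
  let c : Fin j := ⟨1, by omega⟩
  let b : Fin k := ⟨0, by omega⟩
  let e : Fin i := ⟨0, by omega⟩
  have hca : c ≠ a := by simp [a, c]
  let x : AffSpace K ((Fin j × Fin k) ⊕ (Fin i × Fin j)) := ofFun (Sum.elim
    (fun p => (Pi.single a 1 : Fin j → K) p.1 * (Pi.single b 1 : Fin k → K) p.2)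
    (fun p => (Pi.single e 1 : Fin i → K) p.1 * (Pi.single c 1 : Fin j → K) p.2))
  have hx : x ∈ pairVariety K i j k := by
    refine mem_pairVariety_of_eq _ _ _ _ ?_ (fun c d => rfl) (fun r c => rfl)
    simp [Pi.single_apply, hca.symm]
  rw [ringKrullDim_eq_card_of_isTranscendenceBasis
    (isTranscendenceBasis_of_fractionSubalgebra_eq_top _
      (chartHom_chartCoord_injective a b e hca) (pointIdeal _ ⟨x, hx⟩)
      (fractionSubalgebra_chartCoord_eq_top hx (by simp [x]) hca (Or.inl (by simp [x])))),
    card_chartIndex hj]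

theorem not_mem_singularLocus_of_chart [Infinite K]
    {x : AffSpace K ((Fin j × Fin k) ⊕ (Fin i × Fin j))} (hj : 2 ≤ j)
    (hx : x ∈ pairVariety K i j k) {a : Fin j} {b : Fin k} (hM : x (.inl (a, b)) ≠ 0) {e : Fin i}
    {c : Fin j} (hca : c ≠ a) (hN : x (.inr (e, c)) ≠ 0 ∨ i = 1 ∨ j = 2) :
    x ∉ singularLocus (pairVariety K i j k) := by
  rintro ⟨_, hreg⟩
  have := isDomain_coordRing (isIrreducible_pairVariety (K := K) (i := i) (k := k) hj)
  exact hreg (isRegularLocalRing_of_fractionSubalgebra_eq_top _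
    (chartHom_chartCoord_injective a b e hca) _
    (fractionSubalgebra_chartCoord_eq_top hx hM hca hN))

end Charts

/-! ### The singular locus -/

section SingularLocus

variable {K : Type*} [Field K] {i j k : ℕ}

theorem exists_fstPart_ne_zero {x : AffSpace K ((Fin j × Fin k) ⊕ (Fin i × Fin j))}
    (h : fstPart x ≠ 0) : ∃ a b, x (.inl (a, b)) ≠ 0 := by
  by_contra! h'
  exact h (affSpace_ext fun s => h' s.1 s.2)

theorem exists_sndPart_ne_zero {x : AffSpace K ((Fin j × Fin k) ⊕ (Fin i × Fin j))}
    (h : sndPart x ≠ 0) : ∃ a b, x (.inr (a, b)) ≠ 0 := by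
  by_contra! h'
  exact h (affSpace_ext fun s => h' s.1 s.2)

theorem not_mem_singularLocus_of_fstPart_ne_zero [Infinite K] (hi : 1 ≤ i) (hj : 2 ≤ j)
    {x : AffSpace K ((Fin j × Fin k) ⊕ (Fin i × Fin j))} (hx : x ∈ pairVariety K i j k)
    (h1 : fstPart x ≠ 0) (h2 : sndPart x ≠ 0 ∨ i = 1 ∨ j = 2) :
    x ∉ singularLocus (pairVariety K i j k) := by
  obtain ⟨a, b, hab⟩ := exists_fstPart_ne_zero h1
  rcases h2 with h2 | h2
  · obtain ⟨e, c', hN⟩ := exists_sndPart_ne_zero h2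
    obtain ⟨c, hca, hc⟩ : ∃ c, c ≠ a ∧ x (.inr (e, c)) ≠ 0 := by
      by_contra! h0
      have hc' : c' = a := by
        by_contra hc'
        exact hN (h0 c' hc')
      subst hc'
      have h := (mem_pairVariety_iff.1 hx).2.2 e b
      rw [Finset.sum_eq_single c' (fun c _ hc => by rw [h0 c hc, zero_mul]) (by simp)] at h
      exact mul_ne_zero hN hab h
    exact not_mem_singularLocus_of_chart hj hx hab hca (Or.inl hc)
  · have : Nontrivial (Fin j) := Fin.nontrivial_iff_two_le.2 hj
    obtain ⟨c, hca⟩ := exists_ne a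
    exact not_mem_singularLocus_of_chart (e := ⟨0, hi⟩) hj hx hab hca (Or.inr h2)

/-- At `(u vᵀ, 0)` with `u`, `v` nonzero, the variety contains the lines in the directions
`(u' vᵀ, 0)`, `(u v'ᵀ, 0)` and `(0, w zᵀ)` with `z` orthogonal to `u`; they span a space of
dimension `j + k - 1 + i (j - 1)`. -/
theorem mem_singularLocus_of_sndPart_eq_zero [Infinite K] (hi : 1 < i) (hj : 2 < j)
    {x : AffSpace K ((Fin j × Fin k) ⊕ (Fin i × Fin j))} (hx : x ∈ pairVariety K i j k)
    (h1 : fstPart x ≠ 0) (h2 : sndPart x = 0) : x ∈ singularLocus (pairVariety K i j k) := by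
  classical
  obtain ⟨a, b, hab⟩ := exists_fstPart_ne_zero h1
  obtain ⟨u, v, huv⟩ := mem_rankLeOne_iff_exists.1 (mem_pairVariety_iff.1 hx).1
  replace huv : ∀ c d, x (.inl (c, d)) = u c * v d := huv
  have hx2 : ∀ r c, x (.inr (r, c)) = 0 := fun r c => congrFun h2 (r, c)
  rw [huv] at hab
  have hu := left_ne_zero_of_mul hab
  have hv := right_ne_zero_of_mul hab
  let z : {c' : Fin j // c' ≠ a} → Fin j → K := fun c' =>
    u a • Pi.single (c' : Fin j) 1 - u c' • Pi.single a 1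
  have hz : ∀ c', ∑ c, z c' c * u c = 0 := by
    intro c'
    simp [z, Pi.single_apply, mul_sub, mul_comm]
  have hzne : ∀ c' c'' : {c' : Fin j // c' ≠ a}, z c' c'' = if c'' = c' then u a else 0 := by
    intro c' c''
    simp [z, Pi.single_apply, c''.2, Subtype.ext_iff]
  let w : {c' : Fin j // c' ≠ a} ⊕ Fin k ⊕ (Fin i × {c' : Fin j // c' ≠ a}) →
      AffSpace K ((Fin j × Fin k) ⊕ (Fin i × Fin j))
    | .inl c' => ofFun (Sum.elim (fun p => (Pi.single (c' : Fin j) 1 : Fin j → K) p.1 * v p.2) 0)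
    | .inr (.inl d) => ofFun (Sum.elim (fun p => u p.1 * (Pi.single d 1 : Fin k → K) p.2) 0)
    | .inr (.inr q) => ofFun (Sum.elim 0 fun p => (Pi.single q.1 1 : Fin i → K) p.1 * z q.2 p.2)
  refine mem_singularLocus_of_lines hx w ?_ ?_
    (ringKrullDim_coordRing_pairVariety hi.le hj.le (Fin.pos b)) ?_
  · refine Fintype.linearIndependent_iff.2 fun g hg => ?_
    have hs : ∀ s, ∑ l, g l * w l s = 0 := by
      intro s
      have h := congrFun hg s
      have h' : (∑ l, g l • w l : AffSpace K _) s = ∑ l, g l * w l s :=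
        Finset.sum_apply s Finset.univ
          (fun l => (g l • w l : (Fin j × Fin k) ⊕ (Fin i × Fin j) → K))
      rw [← h']
      exact h
    have hg2 : ∀ d, g (.inr (.inl d)) = 0 := by
      intro d
      have h := hs (.inl (a, d))
      have hne : ∀ c' : {c' : Fin j // c' ≠ a}, a ≠ c' := fun c' => c'.2.symm
      simpa [Fintype.sum_sum_type, w, Pi.single_apply, hne, hu] using h
    have hg1 : ∀ c', g (.inl c') = 0 := by
      intro c'
      have h := hs (.inl (c', b))
      simpa [Fintype.sum_sum_type, w, Pi.single_apply, hg2, hv, ← Subtype.ext_iff] using h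
    have hg3 : ∀ q, g (.inr (.inr q)) = 0 := by
      rintro ⟨r, c'⟩
      have h := hs (.inr (r, c'))
      simpa [Fintype.sum_sum_type, Fintype.sum_prod_type, w, Pi.single_apply, hzne, hu] using h
    rintro (c' | d | q)
    exacts [hg1 c', hg2 d, hg3 q]
  · rintro (c' | d | q) t
    · refine mem_pairVariety_of_eq (u + t • Pi.single (c' : Fin j) 1) v 0 0 (by simp) ?_ ?_
      · intro c d
        simp [w, huv]
        ring
      · intro r c
        simp [w, hx2]
    · refine mem_pairVariety_of_eq u (v + t • Pi.single d 1) 0 0 (by simp) ?_ ?_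
      · intro c d
        simp [w, huv]
        ring
      · intro r c
        simp [w, hx2]
    · refine mem_pairVariety_of_eq u v (t • Pi.single q.1 1) (z q.2) (hz _) ?_ ?_
      · intro c d
        simp [w, huv]
      · intro r c
        simp [w, hx2]
        ring
  · simp only [Fintype.card_sum, Fintype.card_fin, Fintype.card_prod, ne_eq,
      Fintype.card_subtype_compl, Fintype.card_unique]
    obtain ⟨i', rfl⟩ := Nat.exists_eq_add_of_le hi
    obtain ⟨j', rfl⟩ := Nat.exists_eq_add_of_le hj
    rw [show 2 + 1 + j' - 1 = 2 + j' by omega]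
    simp only [Nat.succ_eq_add_one]
    ring_nf
    omega

theorem zero_mem_pairVariety : (0 : AffSpace K _) ∈ pairVariety K i j k :=
  mem_pairVariety_of_eq 0 0 0 0 (by simp) (by simp) (by simp)

/-- The variety contains all coordinate axes. -/
theorem zero_mem_singularLocus [Infinite K] (hi : 1 ≤ i) (hj : 2 ≤ j) (hk : 1 ≤ k) :
    0 ∈ singularLocus (pairVariety K i j k) := by
  classical
  refine mem_singularLocus_of_lines zero_mem_pairVariety
    (fun s => ofFun (Pi.single s 1)) (Pi.linearIndependent_single_one _ K) ?_
    (ringKrullDim_coordRing_pairVariety hi hj hk) ?_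
  · rintro (⟨c, d⟩ | ⟨r, c⟩) t
    · refine mem_pairVariety_of_eq (t • Pi.single c 1) (Pi.single d 1) 0 0 (by simp) ?_ ?_
      · intro c' d'
        simp [Pi.single_apply, Prod.ext_iff, ite_and]
        split_ifs <;> rfl
      · simp
    · refine mem_pairVariety_of_eq 0 0 (t • Pi.single r 1) (Pi.single c 1) (by simp) ?_ ?_
      · simp
      · intro r' c'
        simp [Pi.single_apply, Prod.ext_iff, ite_and]
        split_ifs <;> rfl
  · simp only [Fintype.card_sum, Fintype.card_fin, Fintype.card_prod]
    obtain ⟨i', rfl⟩ := Nat.exists_eq_add_of_le hi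
    obtain ⟨j', rfl⟩ := Nat.exists_eq_add_of_le hj
    obtain ⟨k', rfl⟩ := Nat.exists_eq_add_of_le hk
    ring_nf
    omega

/-- Renaming of the coordinates for `(M, N) ↦ (Nᵀ, Mᵀ)`. -/
def transposeEquiv (i j k : ℕ) :
    (Fin j × Fin k) ⊕ (Fin i × Fin j) ≃ (Fin j × Fin i) ⊕ (Fin k × Fin j) :=
  (Equiv.sumComm _ _).trans (Equiv.sumCongr (Equiv.prodComm _ _) (Equiv.prodComm _ _))

/-- The pair `(Nᵀ, Mᵀ)` obtained from `(M, N)`. -/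
def transposePair {K : Type*} (x : AffSpace K ((Fin j × Fin k) ⊕ (Fin i × Fin j))) :
    AffSpace K ((Fin j × Fin i) ⊕ (Fin k × Fin j)) :=
  ofFun (Sum.elim (fun p => x (.inr (p.2, p.1))) fun p => x (.inl (p.2, p.1)))

theorem transposePair_apply {K : Type*} (x : AffSpace K ((Fin j × Fin k) ⊕ (Fin i × Fin j))) (s) :
    transposePair x (transposeEquiv i j k s) = x s := by
  rcases s with s | s <;> rfl

theorem transposePair_mem {x : AffSpace K ((Fin j × Fin k) ⊕ (Fin i × Fin j))}
    (hx : x ∈ pairVariety K i j k) : transposePair x ∈ pairVariety K k j i := by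
  obtain ⟨u, v, w, z, h, hM, hN⟩ := exists_eq_of_mem_pairVariety hx
  refine mem_pairVariety_of_eq z w v u ?_ (fun c d => ?_) fun r c => ?_
  · rw [← h]
    exact Finset.sum_congr rfl fun c _ => mul_comm _ _
  · rw [mul_comm, ← hN]
    rfl
  · rw [mul_comm, ← hM]
    rfl

theorem transposePair_mem_singularLocus {x : AffSpace K ((Fin j × Fin k) ⊕ (Fin i × Fin j))}
    (hx : x ∈ singularLocus (pairVariety K i j k)) :
    transposePair x ∈ singularLocus (pairVariety K k j i) := by
  refine mem_singularLocus_of_equiv (transposeEquiv i j k)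
    (fun z hz => ⟨transposePair z, transposePair_mem hz, transposePair_apply z⟩)
    (fun z hz => ⟨transposePair z, transposePair_mem hz, fun s => ?_⟩)
    (transposePair_apply x) hx
  rcases s with s | s <;> rfl

/-- The singular locus of the variety of pairs. -/
theorem mem_singularLocus_pairVariety_iff [Infinite K] (hi : 1 ≤ i) (hj : 2 ≤ j) (hk : 1 ≤ k)
    {x : AffSpace K ((Fin j × Fin k) ⊕ (Fin i × Fin j))} :
    x ∈ singularLocus (pairVariety K i j k) ↔ x ∈ pairVariety K i j k ∧
      (x = 0 ∨ (sndPart x = 0 ∧ 1 < i ∧ 2 < j) ∨ (fstPart x = 0 ∧ 1 < k ∧ 2 < j)) := by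
  have hT1 : fstPart (transposePair x) = 0 ↔ sndPart x = 0 :=
    ⟨fun h => affSpace_ext fun s => congrFun h (s.2, s.1),
      fun h => affSpace_ext fun s => congrFun h (s.2, s.1)⟩
  have hT2 : sndPart (transposePair x) = 0 ↔ fstPart x = 0 :=
    ⟨fun h => affSpace_ext fun s => congrFun h (s.2, s.1),
      fun h => affSpace_ext fun s => congrFun h (s.2, s.1)⟩
  constructor
  · intro hs
    have hx : x ∈ pairVariety K i j k := hs.1
    refine ⟨hx, ?_⟩
    by_contra! h
    obtain ⟨h0, h1, h2⟩ := h
    by_cases hM : fstPart x = 0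
    · have hN : sndPart x ≠ 0 := fun hN => h0 (eq_zero_of_fstPart_sndPart hM hN)
      refine not_mem_singularLocus_of_fstPart_ne_zero hk hj (transposePair_mem hx)
        (mt hT1.1 hN) (Or.inr ?_) (transposePair_mem_singularLocus hs)
      by_contra! hc
      have := h2 hM (by omega)
      omega
    · refine not_mem_singularLocus_of_fstPart_ne_zero hi hj hx hM ?_ hs
      by_contra! hc
      have := h1 hc.1 (by omega)
      omega
  · rintro ⟨hx, h⟩
    by_cases h0 : x = 0
    · exact h0 ▸ zero_mem_singularLocus hi hj hk
    rcases h.resolve_left h0 with ⟨hN, hi, hj⟩ | ⟨hM, hk, hj⟩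
    · exact mem_singularLocus_of_sndPart_eq_zero hi hj hx
        (fun hM => h0 (eq_zero_of_fstPart_sndPart hM hN)) hN
    · have := transposePair_mem_singularLocus (mem_singularLocus_of_sndPart_eq_zero hk hj
        (transposePair_mem hx) (mt hT1.1 fun hN => h0 (eq_zero_of_fstPart_sndPart hM hN))
        (hT2.2 hM))
      have hxx : transposePair (transposePair x) = x := affSpace_ext fun s => by
        rcases s with s | s <;> rfl
      rwa [hxx] at this

end SingularLocus

/-! ### The exceptional isomorphism and the quadratic cone -/

section Isomorphism

variable {K : Type*} [Field K] {i j k : ℕ}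

theorem algIsomorphic_of_polyMap {σ τ : Type*} {X : Set (AffSpace K σ)} {Y : Set (AffSpace K τ)}
    (p : τ → MvPolynomial σ K) (q : σ → MvPolynomial τ K) (hp : ∀ x ∈ X, polyMap p x ∈ Y)
    (hq : ∀ y ∈ Y, polyMap q y ∈ X) (hqp : ∀ x ∈ X, polyMap q (polyMap p x) = x)
    (hpq : ∀ y ∈ Y, polyMap p (polyMap q y) = y) : AlgIsomorphic X Y :=
  ⟨⟨fun x => ⟨polyMap p x, hp x x.2⟩, fun y => ⟨polyMap q y, hq y y.2⟩,
    fun x => Subtype.ext (hqp x x.2), fun y => Subtype.ext (hpq y y.2)⟩,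
    ⟨p, fun _ _ => rfl⟩, ⟨q, fun _ _ => rfl⟩⟩

/-- The coordinates of the matrix obtained from `(M, N)`, for `j = 2`, by putting the rows
`(M 1 d, - M 0 d)` below the matrix `N`. -/
noncomputable def stackPair (K : Type*) [Field K] (i k : ℕ) :
    Fin (i + k) × Fin 2 → MvPolynomial ((Fin 2 × Fin k) ⊕ (Fin i × Fin 2)) K := fun p =>
  Fin.addCases (fun r => X (.inr (r, p.2)))
    (fun d => if p.2 = 0 then X (.inl (1, d)) else -X (.inl (0, d))) p.1

/-- The coordinates of the pair recovered from the stacked matrix. -/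
noncomputable def unstackPair (K : Type*) [Field K] (i k : ℕ) :
    (Fin 2 × Fin k) ⊕ (Fin i × Fin 2) → MvPolynomial (Fin (i + k) × Fin 2) K
  | .inl (c, d) => if c = 0 then -X (Fin.natAdd i d, 1) else X (Fin.natAdd i d, 0)
  | .inr (r, c) => X (Fin.castAdd k r, c)

theorem polyMap_stackPair_castAdd (x : AffSpace K ((Fin 2 × Fin k) ⊕ (Fin i × Fin 2))) (r : Fin i)
    (c : Fin 2) : polyMap (stackPair K i k) x (Fin.castAdd k r, c) = x (.inr (r, c)) := by
  simp [polyMap, stackPair]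

theorem polyMap_stackPair_natAdd_zero (x : AffSpace K ((Fin 2 × Fin k) ⊕ (Fin i × Fin 2)))
    (d : Fin k) : polyMap (stackPair K i k) x (Fin.natAdd i d, 0) = x (.inl (1, d)) := by
  simp [polyMap, stackPair]

theorem polyMap_stackPair_natAdd_one (x : AffSpace K ((Fin 2 × Fin k) ⊕ (Fin i × Fin 2)))
    (d : Fin k) : polyMap (stackPair K i k) x (Fin.natAdd i d, 1) = -x (.inl (0, d)) := by
  simp [polyMap, stackPair]

theorem polyMap_unstackPair_inl_zero (y : AffSpace K (Fin (i + k) × Fin 2)) (d : Fin k) :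
    polyMap (unstackPair K i k) y (.inl (0, d)) = -y (Fin.natAdd i d, 1) := by
  simp [polyMap, unstackPair]

theorem polyMap_unstackPair_inl_one (y : AffSpace K (Fin (i + k) × Fin 2)) (d : Fin k) :
    polyMap (unstackPair K i k) y (.inl (1, d)) = y (Fin.natAdd i d, 0) := by
  simp [polyMap, unstackPair]

theorem polyMap_unstackPair_inr (y : AffSpace K (Fin (i + k) × Fin 2)) (r : Fin i) (c : Fin 2) :
    polyMap (unstackPair K i k) y (.inr (r, c)) = y (Fin.castAdd k r, c) := by
  simp [polyMap, unstackPair]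

/-- A matrix with two columns has rank at most one if and only if the minors on the full rows
vanish. -/
theorem mem_rankLeOne_two_iff {m : ℕ} {x : AffSpace K (Fin m × Fin 2)} :
    x ∈ rankLeOne K m 2 ↔ ∀ a a', x (a, 0) * x (a', 1) = x (a, 1) * x (a', 0) := by
  rw [mem_rankLeOne_iff_minors]
  refine ⟨fun h a a' => h a a' 0 1, fun h a a' b b' => ?_⟩
  have h1 := h a a'
  fin_cases b <;> fin_cases b' <;> simp only [Fin.zero_eta, Fin.mk_one]
  · exact h1
  · exact h1.symm

theorem mem_rankLeOne_two_iff' {n : ℕ} {x : AffSpace K (Fin 2 × Fin n)} :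
    x ∈ rankLeOne K 2 n ↔ ∀ b b', x (0, b) * x (1, b') = x (0, b') * x (1, b) := by
  rw [mem_rankLeOne_iff_minors]
  refine ⟨fun h b b' => h 0 1 b b', fun h a a' b b' => ?_⟩
  have h1 := h b b'
  fin_cases a <;> fin_cases a' <;> simp only [Fin.zero_eta, Fin.mk_one]
  · exact mul_comm _ _
  · exact h1
  · rw [mul_comm, ← h1, mul_comm]
  · exact mul_comm _ _

theorem polyMap_stackPair_mem_iff (x : AffSpace K ((Fin 2 × Fin k) ⊕ (Fin i × Fin 2))) :
    polyMap (stackPair K i k) x ∈ rankLeOne K (i + k) 2 ↔ x ∈ pairVariety K i 2 k := by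
  rw [mem_pairVariety_iff, mem_rankLeOne_two_iff, mem_rankLeOne_two_iff, mem_rankLeOne_two_iff',
    Fin.forall_fin_add]
  simp only [Fin.forall_fin_add, polyMap_stackPair_castAdd, polyMap_stackPair_natAdd_zero,
    polyMap_stackPair_natAdd_one, Fin.sum_univ_two, fstPart, sndPart]
  constructor
  · rintro ⟨h1, h2⟩
    refine ⟨fun b b' => ?_, fun a a' => (h1 a).1 a', fun r d => ?_⟩
    · linear_combination (h2 b).2 b'
    · linear_combination -(h1 r).2 d
  · rintro ⟨h1, h2, h3⟩
    refine ⟨fun r => ⟨h2 r, fun d => ?_⟩, fun d => ⟨fun r => ?_, fun d' => ?_⟩⟩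
    · linear_combination -h3 r d
    · linear_combination h3 r d
    · linear_combination h1 d d'

theorem algIsomorphic_pairVariety_two :
    AlgIsomorphic (pairVariety K i 2 k) (rankLeOne K (i + k) 2) := by
  have h1 : ∀ x, polyMap (unstackPair K i k) (polyMap (stackPair K i k) x) = x := by
    refine fun x => affSpace_ext ?_
    rintro (⟨c, d⟩ | ⟨r, c⟩)
    · fin_cases c
      · simp only [Fin.zero_eta]
        rw [polyMap_unstackPair_inl_zero, polyMap_stackPair_natAdd_one, neg_neg]
      · simp only [Fin.mk_one]
        rw [polyMap_unstackPair_inl_one, polyMap_stackPair_natAdd_zero]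
    · rw [polyMap_unstackPair_inr, polyMap_stackPair_castAdd]
  have h2 : ∀ y, polyMap (stackPair K i k) (polyMap (unstackPair K i k) y) = y := by
    refine fun y => affSpace_ext ?_
    rintro ⟨a, c⟩
    induction a using Fin.addCases with
    | left r => rw [polyMap_stackPair_castAdd, polyMap_unstackPair_inr]
    | right d =>
      fin_cases c
      · simp only [Fin.zero_eta]
        rw [polyMap_stackPair_natAdd_zero, polyMap_unstackPair_inl_one]
      · simp only [Fin.mk_one]
        rw [polyMap_stackPair_natAdd_one, polyMap_unstackPair_inl_zero, neg_neg]
  refine algIsomorphic_of_polyMap (stackPair K i k) (unstackPair K i k)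
    (fun x hx => (polyMap_stackPair_mem_iff x).2 hx) (fun y hy => ?_) (fun x _ => h1 x)
    fun y _ => h2 y
  rw [← polyMap_stackPair_mem_iff, h2]
  exact hy

/-- The bilinear form `(x, y) ↦ N(x) M(y)` on pairs of a column `M` and a row `N`. -/
noncomputable def pairingBilin (K : Type*) [Field K] (j : ℕ) :
    LinearMap.BilinForm K (AffSpace K ((Fin j × Fin 1) ⊕ (Fin 1 × Fin j))) :=
  LinearMap.mk₂ K (fun x y => ∑ c, x (.inr (0, c)) * y (.inl (c, 0)))
    (fun x x' y => by simp [add_mul, Finset.sum_add_distrib])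
    (fun r x y => by simp [mul_assoc, Finset.mul_sum])
    (fun x y y' => by simp [mul_add, Finset.sum_add_distrib])
    (fun r x y => by simp [Finset.mul_sum, mul_left_comm])

theorem pairingBilin_apply (x y : AffSpace K ((Fin j × Fin 1) ⊕ (Fin 1 × Fin j))) :
    pairingBilin K j x y = ∑ c, x (.inr (0, c)) * y (.inl (c, 0)) := rfl

theorem isNondegenerateQuadraticCone_pairVariety :
    IsNondegenerateQuadraticCone (pairVariety K 1 j 1) := by
  classical
  refine ⟨(pairingBilin K j).toQuadraticMap, ?_, ?_⟩
  · have hker : (QuadraticMap.polarBilin (pairingBilin K j).toQuadraticMap).ker = ⊥ := by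
      refine eq_bot_iff.2 fun x hx => ?_
      have h : ∀ y, pairingBilin K j x y + pairingBilin K j y x = 0 := by
        intro y
        have h := LinearMap.congr_fun (LinearMap.mem_ker.1 hx) y
        rw [QuadraticMap.polarBilin_apply_apply, QuadraticMap.polar] at h
        simp only [LinearMap.BilinMap.toQuadraticMap_apply, map_add, LinearMap.add_apply,
          LinearMap.zero_apply] at h
        rw [← h]
        ring
      simp only [pairingBilin_apply] at h
      refine affSpace_ext ?_
      rintro (⟨c, d⟩ | ⟨r, c⟩)
      · have := h (ofFun (Pi.single (.inr (0, c)) 1))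
        simpa [Pi.single_apply, Subsingleton.elim d 0] using this
      · have := h (ofFun (Pi.single (.inl (c, 0)) 1))
        simpa [Pi.single_apply, Subsingleton.elim r 0] using this
    refine ⟨eq_bot_iff.2 (hker ▸ fun x hx =>
      QuadraticMap.radical_le_ker_polarBilin hx), ?_⟩
    rw [hker]
    simp
  · ext x
    rw [mem_pairVariety_iff, mem_rankLeOne_iff_minors, mem_rankLeOne_iff_minors]
    constructor
    · exact fun h => h.2.2 0 0
    · intro h
      refine ⟨fun a a' b b' => by rw [Subsingleton.elim b b'],
        fun a a' b b' => by rw [Subsingleton.elim a a', mul_comm], fun r d => ?_⟩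
      rw [Subsingleton.elim r 0, Subsingleton.elim d 0]
      exact h

end Isomorphism

/-! ### Isolatedness of the origin and the description of the singular locus by products -/

theorem isIsolatedSingularity_pairVariety_iff {K : Type*} [Field K] [Infinite K] {i j k : ℕ}
    (hi : 1 ≤ i) (hj : 2 ≤ j) (hk : 1 ≤ k) :
    IsIsolatedSingularity (pairVariety K i j k) 0 ↔ j = 2 ∨ (i = 1 ∧ k = 1) := by
  constructor
  · intro h
    by_contra! hc
    have hj' : 2 < j := by omega
    by_cases hi' : 1 < i
    · refine not_isIsolatedSingularity_of_line (x := ofFun (Sum.elim 1 0))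
        (fun h0 => ?_) (fun t => ?_) h
      · have := congrFun h0 (Sum.inl (⟨0, by omega⟩, ⟨0, by omega⟩))
        simp at this
      · refine (mem_singularLocus_pairVariety_iff hi hj hk).2 ⟨?_, Or.inr (Or.inl ⟨?_, hi', hj'⟩)⟩
        · exact mem_pairVariety_of_eq (t • 1) 1 0 0 (by simp) (by simp) (by simp)
        · exact affSpace_ext fun s => mul_zero t
    · have hk' : 1 < k := by omega
      refine not_isIsolatedSingularity_of_line (x := ofFun (Sum.elim 0 1))
        (fun h0 => ?_) (fun t => ?_) h
      · have := congrFun h0 (Sum.inr (⟨0, by omega⟩, ⟨0, by omega⟩))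
        simp at this
      · refine (mem_singularLocus_pairVariety_iff hi hj hk).2 ⟨?_, Or.inr (Or.inr ⟨?_, hk', hj'⟩)⟩
        · exact mem_pairVariety_of_eq 0 0 (t • 1) 1 (by simp) (by simp) (by simp)
        · exact affSpace_ext fun s => mul_zero t
  · intro h
    refine ⟨Set.univ, isOpen_univ, ?_⟩
    ext x
    simp only [Set.univ_inter, mem_singularLocus_pairVariety_iff hi hj hk, Set.mem_singleton_iff]
    constructor
    · rintro ⟨-, h0 | ⟨-, h1, h2⟩ | ⟨-, h1, h2⟩⟩
      · exact h0
      · omega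
      · omega
    · rintro rfl
      exact ⟨zero_mem_pairVariety, Or.inl rfl⟩

theorem mem_prodSet_rankLeOne_zero_iff {K : Type*} [Field K] {i j k : ℕ}
    {x : AffSpace K ((Fin j × Fin k) ⊕ (Fin i × Fin j))} :
    x ∈ prodSet (rankLeOne K j k) {0} ↔ x ∈ pairVariety K i j k ∧ sndPart x = 0 := by
  rw [mem_pairVariety_iff]
  constructor
  · rintro ⟨h1, h2⟩
    have hx : ∀ r c, x (.inr (r, c)) = 0 := fun r c => congrFun h2 (r, c)
    refine ⟨⟨h1, ?_, fun r d => by simp [hx]⟩, h2⟩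
    exact mem_rankLeOne_iff_exists.2 ⟨0, 0, fun r c => by
      rw [Pi.zero_apply, zero_mul]; exact hx r c⟩
  · exact fun h => ⟨h.1.1, h.2⟩

theorem mem_prodSet_zero_rankLeOne_iff {K : Type*} [Field K] {i j k : ℕ}
    {x : AffSpace K ((Fin j × Fin k) ⊕ (Fin i × Fin j))} :
    x ∈ prodSet {0} (rankLeOne K i j) ↔ x ∈ pairVariety K i j k ∧ fstPart x = 0 := by
  rw [mem_pairVariety_iff]
  constructor
  · rintro ⟨h1, h2⟩
    have hx : ∀ c d, x (.inl (c, d)) = 0 := fun c d => congrFun h1 (c, d)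
    refine ⟨⟨?_, h2, fun r d => by simp [hx]⟩, h1⟩
    exact mem_rankLeOne_iff_exists.2 ⟨0, 0, fun c d => by
      rw [Pi.zero_apply, zero_mul]; exact hx c d⟩
  · exact fun h => ⟨h.2, h.1.2.1⟩

end RankOnePairs

theorem mainTheorem6 (K : Type*) [Field K] [IsAlgClosed K] (i j k : ℕ)
    (hi : 1 ≤ i) (hj : 2 ≤ j) (hk : 1 ≤ k) :
    (IsClosed (RankOnePairs.pairVariety K i j k) ∧
      IsIrreducible (RankOnePairs.pairVariety K i j k) ∧
      topologicalKrullDim (RankOnePairs.pairVariety K i j k) = ((2 * j + i + k - 3 : ℕ) : ℕ∞)) ∧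
    (0 ∈ RankOnePairs.singularLocus (RankOnePairs.pairVariety K i j k)) ∧
    (RankOnePairs.IsIsolatedSingularity (RankOnePairs.pairVariety K i j k) 0 ↔
      j = 2 ∨ (i = 1 ∧ k = 1)) ∧
    (1 < i → 2 < j →
      RankOnePairs.singularLocus (RankOnePairs.pairVariety K i j 1) =
        RankOnePairs.prodSet (RankOnePairs.rankLeOne K j 1) {0}) ∧
    (2 < j → 1 < k →
      RankOnePairs.singularLocus (RankOnePairs.pairVariety K 1 j k) =
        RankOnePairs.prodSet {0} (RankOnePairs.rankLeOne K 1 j)) ∧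
    (1 < i → 1 < k → 2 < j →
      RankOnePairs.componentsOf (RankOnePairs.singularLocus (RankOnePairs.pairVariety K i j k)) =
        {RankOnePairs.prodSet (RankOnePairs.rankLeOne K j k) {0},
          RankOnePairs.prodSet {0} (RankOnePairs.rankLeOne K i j)} ∧
      RankOnePairs.prodSet (RankOnePairs.rankLeOne K j k) {0} ≠
        RankOnePairs.prodSet {0} (RankOnePairs.rankLeOne K i j)) ∧
    RankOnePairs.AlgIsomorphic (RankOnePairs.pairVariety K i 2 k)
      (RankOnePairs.rankLeOne K (i + k) 2) ∧
    (RankOnePairs.IsNondegenerateQuadraticCone (RankOnePairs.pairVariety K 1 j 1) ∧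
      topologicalKrullDim (RankOnePairs.pairVariety K 1 j 1) = ((2 * j - 1 : ℕ) : ℕ∞)) := by
  open RankOnePairs in
  have : Infinite K := IsAlgClosed.instInfinite
  have hdim : ∀ {i k : ℕ}, 1 ≤ i → 1 ≤ k →
      topologicalKrullDim (pairVariety K i j k) = ((2 * j + i + k - 3 : ℕ) : ℕ∞) := by
    intro i k hi hk
    rw [topologicalKrullDim_eq_ringKrullDim_coordRing isClosed_pairVariety,
      ringKrullDim_coordRing_pairVariety hi hj hk]
    rfl
  refine ⟨⟨isClosed_pairVariety, isIrreducible_pairVariety hj, hdim hi hk⟩,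
    zero_mem_singularLocus hi hj hk, isIsolatedSingularity_pairVariety_iff hi hj hk,
    fun hi' hj' => ?_, fun hj' hk' => ?_, fun hi' hk' hj' => ?_,
    algIsomorphic_pairVariety_two, isNondegenerateQuadraticCone_pairVariety, ?_⟩
  · ext x
    rw [mem_singularLocus_pairVariety_iff hi hj le_rfl, mem_prodSet_rankLeOne_zero_iff]
    refine and_congr_right fun _ => ⟨?_, fun h => Or.inr (Or.inl ⟨h, hi', hj'⟩)⟩
    rintro (rfl | ⟨h, -⟩ | ⟨-, h, -⟩)
    · rfl
    · exact h
    · exact absurd h (lt_irrefl _)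
  · ext x
    rw [mem_singularLocus_pairVariety_iff le_rfl hj hk, mem_prodSet_zero_rankLeOne_iff]
    refine and_congr_right fun _ => ⟨?_, fun h => Or.inr (Or.inr ⟨h, hk', hj'⟩)⟩
    rintro (rfl | ⟨-, h, -⟩ | ⟨h, -⟩)
    · rfl
    · exact absurd h (lt_irrefl _)
    · exact h
  · have hsing : singularLocus (pairVariety K i j k) =
        prodSet (rankLeOne K j k) {0} ∪ prodSet {0} (rankLeOne K i j) := by
      ext x
      rw [mem_singularLocus_pairVariety_iff hi hj hk, Set.mem_union,
        mem_prodSet_rankLeOne_zero_iff, mem_prodSet_zero_rankLeOne_iff, ← and_or_left]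
      refine and_congr_right fun _ => ⟨?_, ?_⟩
      · rintro (rfl | ⟨h, -⟩ | ⟨h, -⟩)
        exacts [Or.inl rfl, Or.inl h, Or.inr h]
      · rintro (h | h)
        exacts [Or.inr (Or.inl ⟨h, hi', hj'⟩), Or.inr (Or.inr ⟨h, hk', hj'⟩)]
    have hAB : ¬ prodSet (rankLeOne K j k) {0} ⊆
        prodSet ({0} : Set (AffSpace K (Fin j × Fin k))) (rankLeOne K i j) := by
      intro h
      have h1 : ofFun (Sum.elim 1 0) ∈ prodSet (rankLeOne K j k)
          ({0} : Set (AffSpace K (Fin i × Fin j))) :=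
        ⟨mem_rankLeOne_iff_exists.2 ⟨1, 1, fun c d => (mul_one 1).symm⟩, rfl⟩
      have h2 := congrFun (h h1).1 (⟨0, by omega⟩, ⟨0, by omega⟩)
      exact one_ne_zero (α := K) h2
    have hBA : ¬ prodSet ({0} : Set (AffSpace K (Fin j × Fin k))) (rankLeOne K i j) ⊆
        prodSet (rankLeOne K j k) {0} := by
      intro h
      have h1 : ofFun (Sum.elim 0 1) ∈ prodSet ({0} : Set (AffSpace K (Fin j × Fin k)))
          (rankLeOne K i j) :=
        ⟨rfl, mem_rankLeOne_iff_exists.2 ⟨1, 1, fun c d => (mul_one 1).symm⟩⟩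
      have h2 := congrFun (h h1).2 (⟨0, by omega⟩, ⟨0, by omega⟩)
      exact one_ne_zero (α := K) h2
    refine ⟨?_, fun h => hAB h.subset⟩
    rw [hsing]
    exact componentsOf_union (isClosed_prodSet isClosed_rankLeOne isClosed_singleton_zero)
      (isClosed_prodSet isClosed_singleton_zero isClosed_rankLeOne)
      isIrreducible_prodSet_rankLeOne_zero isIrreducible_prodSet_zero_rankLeOne hAB hBA
  · rw [hdim le_rfl le_rfl, show 2 * j + 1 + 1 - 3 = 2 * j - 1 by omega]
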